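/- **Theorem (framed Khovanov homology of the torus links $T(2,n)$).** *Conventions.* Let $D$ be an unoriented link diagram with a fixed linear order on its crossings. A Kauffman state $s$ puts a marker $A$ or $B$ on every crossing; the $A$-smoothing of a crossing joins the two regions swept by the upper strand when it is turned counterclockwise, and the $B$-smoothing joins the other two. Let $D_s$ be the resulting set of circles. An enhanced state $S$ is a state $s$ together with a sign $\varepsilon(c)\in\{+,-\}$ for every circle $c\in D_s$. Put $\sigma(s)=|s^{-1}(A)|-|s^{-1}(B)|$ and $\tau(S)=|\varepsilon^{-1}(+)|-|\varepsilon^{-1}(-)|$. Let $C_{a,b}(D)$ be the free abelian group on the enhanced states with $a=\sigma(s)$ and $b=\sigma(s)+2\tau(S)$, and define $$\partial_{a,b}\colon C_{a,b}(D)\to C_{a-2,b}(D),\qquad \partial_{a,b}(S)=\sum_{S'}(-1)^{t(S,S')}(S,S')\,S'.$$ Here $(S,S')=1$ if there is a crossing $v$ with marker $A$ in $S$ and $B$ in $S'$, all other markers agree, $\tau(S')=\tau(S)+1$, and all circles not passing through $v$ have the same sign in $S$ and $S'$; otherwise $(S,S')=0$. The number $t(S,S')$ counts the crossings after $v$ that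 have marker $B$ in $S$. The framed (Viro convention) Khovanov homology of $D$ is $H_{a,b}(D)=\ker\partial_{a,b}/\operatorname{im}\partial_{a+2,b}$. *Statement.* Let $n\ge 1$ be an integer and let $T(2,n)$ be given by its standard diagram, the closure of the two-strand braid $\sigma_1^n$ with $n$ positive crossings, ordered along the braid (for $n=1$ this is the unknot with one positive kink). Then, for all integers $a,b$, $$H_{a,b}(T(2,n))\cong\begin{cases} \mathbb Z & \text{if } (a,b)=(n,n),\\ \mathbb Z & \text{if } n\ge 2 \text{ and } (a,b)=(-n,-3n),\\ \mathbb Z & \text{if } (a,b)=(n-2s,\,n-4s+4) \text{ for some even } s \text{ with } 0\le s\le n,\\ \mathbb Z & \text{if } (a,b)=(n-2s,\,n-4s) \text{ for some odd } s \text{ with } 3\le s\le n,\\ \mathbb Z_2 & \text{if } (a,b)=(n-2s,\,n-4s+4) \text{ for some odd } s \text{ with } 3\le s\le n,\\ 0 & \text{otherwise.} \end{cases}$$ -/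

import Mathlib

/-- The two markers that a Kauffman state can put on a crossing. -/
inductive Marker where
  | A
  | B
  deriving DecidableEq

instance : Fintype Marker where
  elems := {Marker.A, Marker.B}
  complete := by rintro (_ | _) <;> simp

/-- The two signs that an enhanced Kauffman state can put on a circle. -/
inductive CircleSign where
  | plus
  | minus
  deriving DecidableEq

instance : Fintype CircleSign where
  elems := {CircleSign.plus, CircleSign.minus}
  complete := by rintro (_ | _) <;> simp

/-- An unoriented planar diagram (PD) code with set of crossings `X` and set of edges `E`.
At a crossing `v`, the four edges `label v 0`, `label v 1`, `label v 2`, `label v 3` are listed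
counterclockwise, and `label v 0`, `label v 2` are the two ends of the lower strand (so
`label v 1`, `label v 3` are the two ends of the upper strand).
Every edge has two ends at crossings, or none: in the latter case it is a
component of the diagram without crossings. -/
structure PDCode (X E : Type) where
  label : X → Fin 4 → E
  two_ends : ∀ e : E, Nat.card {p : X × Fin 4 // label p.1 p.2 = e} = 0 ∨
    Nat.card {p : X × Fin 4 // label p.1 p.2 = e} = 2

namespace PDCode

variable {X E : Type}

/-- `D.Arc s e f`: smoothing the crossings of `D` by the state `s` produces an arc
joining an end of the edge `e` to an end of the edge `f`. The `A`-smoothing joins the two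
regions swept by the upper strand when it is turned counterclockwise, so its arcs are `0 - 1`
and `2 - 3`; the arcs of the `B`-smoothing are `0 - 3` and `1 - 2`. -/
def Arc (D : PDCode X E) (s : X → Marker) (e f : E) : Prop :=
  ∃ v : X,
    (s v = Marker.A ∧ ((e = D.label v 0 ∧ f = D.label v 1) ∨
      (e = D.label v 2 ∧ f = D.label v 3))) ∨
    (s v = Marker.B ∧ ((e = D.label v 0 ∧ f = D.label v 3) ∨
      (e = D.label v 1 ∧ f = D.label v 2)))

/-- The set `D_s` of circles of the smoothed diagram: the classes of edges joined by arcs. -/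
def Circle (D : PDCode X E) (s : X → Marker) : Type :=
  Quotient (Relation.EqvGen.setoid (D.Arc s))

/-- The circle of `D_s` that contains the edge `e`. -/
def circleOf (D : PDCode X E) (s : X → Marker) (e : E) : D.Circle s :=
  Quotient.mk (Relation.EqvGen.setoid (D.Arc s)) e

/-- Enhanced Kauffman states: a state `s` and a sign for every circle of `D_s`. -/
def EnhancedState (D : PDCode X E) : Type :=
  Σ s : X → Marker, (D.Circle s → CircleSign)

instance [Finite E] (D : PDCode X E) (s : X → Marker) : Finite (D.Circle s) :=
  inferInstanceAs (Finite (Quotient (Relation.EqvGen.setoid (D.Arc s))))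

instance [Finite X] [Finite E] (D : PDCode X E) : Finite D.EnhancedState :=
  inferInstanceAs (Finite (Σ s : X → Marker, (D.Circle s → CircleSign)))

/-- The number of `A`-markers minus the number of `B`-markers. -/
noncomputable def sigma {D : PDCode X E} (S : D.EnhancedState) : ℤ :=
  (Nat.card {v : X // S.1 v = Marker.A} : ℤ) - (Nat.card {v : X // S.1 v = Marker.B} : ℤ)

/-- The number of positive circles minus the number of negative circles. -/
noncomputable def tau {D : PDCode X E} (S : D.EnhancedState) : ℤ :=
  (Nat.card {c : D.Circle S.1 // S.2 c = CircleSign.plus} : ℤ) -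
    (Nat.card {c : D.Circle S.1 // S.2 c = CircleSign.minus} : ℤ)

/-- The set `𝒮_{a,b}` of enhanced states of bidegree `(a, b)`. -/
def BidegreeState (D : PDCode X E) (a b : ℤ) : Type :=
  {S : D.EnhancedState // a = sigma S ∧ b = sigma S + 2 * tau S}

instance [Finite X] [Finite E] (D : PDCode X E) (a b : ℤ) : Finite (D.BidegreeState a b) :=
  inferInstanceAs (Finite {S : D.EnhancedState // a = sigma S ∧ b = sigma S + 2 * tau S})

noncomputable instance [Finite X] [Finite E] (D : PDCode X E) (a b : ℤ) :
    Fintype (D.BidegreeState a b) :=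
  Fintype.ofFinite _

/-- The chain group `C_{a,b}`, free abelian on the enhanced states of bidegree `(a, b)`. -/
abbrev Chain (D : PDCode X E) (a b : ℤ) : Type :=
  D.BidegreeState a b →₀ ℤ

/-- `S` and `S'` are incident, and `v` is the crossing where they differ: the marker of `v`
changes from `A` to `B`, all other markers agree, `τ` grows by one, and the circles of `D_s` that
do not pass through `v` keep their signs. -/
def IncidentAt (D : PDCode X E) (v : X) (S S' : D.EnhancedState) : Prop :=
  S.1 v = Marker.A ∧ S'.1 v = Marker.B ∧ (∀ w : X, w ≠ v → S'.1 w = S.1 w) ∧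
    tau S' = tau S + 1 ∧
    ∀ e : E, (∀ i : Fin 4, D.circleOf S.1 (D.label v i) ≠ D.circleOf S.1 e) →
      S'.2 (D.circleOf S'.1 e) = S.2 (D.circleOf S.1 e)

open Classical in
/-- The coefficient `(-1)^{t(S,S')} (S,S')` of the differential. Two enhanced states are incident
at no more than one crossing `v`, so the sum has at most one nonzero term; the exponent counts
the crossings after `v` that carry a `B`-marker. -/
noncomputable def coefficient [Fintype X] [LinearOrder X] (D : PDCode X E)
    (S S' : D.EnhancedState) : ℤ :=
  ∑ v : X, if D.IncidentAt v S S' then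
    (-1) ^ Nat.card {w : X // v < w ∧ S.1 w = Marker.B} else 0

/-- The component `C_{a,b} → C_{a',b}` of the differential. It vanishes unless `a' = a - 2`, since
`σ` drops by two between incident states; `∂_{a,b}` is the component with `a' = a - 2`. -/
noncomputable def differential [Fintype X] [LinearOrder X] [Finite E] (D : PDCode X E)
    (a a' b : ℤ) : D.Chain a b →ₗ[ℤ] D.Chain a' b :=
  Finsupp.linearCombination ℤ fun S : D.BidegreeState a b =>
    ∑ S' : D.BidegreeState a' b, D.coefficient S.1 S'.1 • Finsupp.single S' (1 : ℤ)

/-- The framed Khovanov homology `H_{a,b}(D) = ker ∂_{a,b} / im ∂_{a+2,b}`. -/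
abbrev KhovanovHomology [Fintype X] [LinearOrder X] [Finite E] (D : PDCode X E) (a b : ℤ) : Type :=
  LinearMap.ker (D.differential a (a - 2) b) ⧸
    (LinearMap.range (D.differential (a + 2) a b)).submoduleOf
      (LinearMap.ker (D.differential a (a - 2) b))

end PDCode

/-- The edges at the crossing `i` of the closure of the two-strand braid `σ₁ⁿ`. Crossings are
numbered cyclically from bottom to top; `(i, false)` and `(i, true)` are the left and right edges
that enter the crossing `i` from below, and those that leave it upwards enter the next
crossing. The upper strand runs from bottom left to top right, so the crossing is positive when
both strands are directed upwards. -/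
def torusLabel (n : ℕ) (i : Fin n) : Fin 4 → Fin n × Bool :=
  ![(i, true), (finRotate n i, true), (finRotate n i, false), (i, false)]

theorem torusLabel_two_ends (n : ℕ) (e : Fin n × Bool) :
    Nat.card {p : Fin n × Fin 4 // torusLabel n p.1 p.2 = e} = 2 := by
  obtain ⟨j, c⟩ := e
  have key : ∀ k l : Fin 4, k ≠ l →
      (∀ p : Fin n × Fin 4, torusLabel n p.1 p.2 = (j, c) ↔
        p = (j, k) ∨ p = ((finRotate n).symm j, l)) →
      Nat.card {p : Fin n × Fin 4 // torusLabel n p.1 p.2 = (j, c)} = 2 := by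
    intro k l hkl h
    have hs : {p : Fin n × Fin 4 | torusLabel n p.1 p.2 = (j, c)} =
        {(j, k), ((finRotate n).symm j, l)} := by
      ext p
      simpa using h p
    have h2 := Set.ncard_pair (a := (j, k)) (b := ((finRotate n).symm j, l))
      (fun hp => hkl (congrArg Prod.snd hp))
    rw [← hs] at h2
    exact h2
  cases c
  · refine key 3 2 (by decide) ?_
    rintro ⟨i, m⟩
    unfold torusLabel
    generalize finRotate n = r
    fin_cases m <;> simp [Equiv.eq_symm_apply]
  · refine key 0 1 (by decide) ?_
    rintro ⟨i, m⟩
    unfold torusLabel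
    generalize finRotate n = r
    fin_cases m <;> simp [Equiv.eq_symm_apply]

/-- The standard diagram of the torus link `T(2, n)`: the closure of the two-strand braid `σ₁ⁿ`,
with `n` positive crossings, ordered along the braid. -/
def torusLinkDiagram (n : ℕ) : PDCode (Fin n) (Fin n × Bool) where
  label := torusLabel n
  two_ends := fun e => Or.inr (torusLabel_two_ends n e)

/-!
Resolving the last crossing of the closed braid exhibits the complex of `T(2, n + 1)` as the mapping
cone of a map from the complex of `T(2, n)` (`A`-smoothing) to the complex of a circle with `n`
kinks (`B`-smoothing). Each kink is removed by the retraction `z ↦ z₋ - x z₊`, where `x` is the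
action of `X` on the rest of the diagram, so the circle with `n` kinks reduces to a single copy of
`A = ℤ[X]/(X²)`. Iterating over the crossings retracts the whole complex onto

`A ⊗ A → A → A → A → ⋯`  (`n` copies of `A` after `A ⊗ A`),

whose first map is the multiplication and whose further maps are alternately `0` and `2X`. The
homology of this complex is read off, since every bidegree except `(n, n)` contains at most one
generator.
-/

namespace Khovanov

open CircleSign Module

section Algebra

variable {R M M' M'' N N' : Type*} [Ring R] [AddCommGroup M] [Module R M]
  [AddCommGroup M'] [Module R M'] [AddCommGroup M''] [Module R M'']
  [AddCommGroup N] [Module R N] [AddCommGroup N'] [Module R N']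

/-- A surjective chain map with acyclic kernel between modules with differentials. The condition
`d * d = 0` is not part of the definition. -/
structure IsAcyclicSurjection (d : End R M) (d' : End R M') (f : M →ₗ[R] M') : Prop where
  map_diff : ∀ z, f (d z) = d' (f z)
  surjective : Function.Surjective f
  exact_ker : ∀ z, d z = 0 → f z = 0 → ∃ y, f y = 0 ∧ d y = z

namespace IsAcyclicSurjection

variable {d : End R M} {d' : End R M'} {d'' : End R M''} {f : M →ₗ[R] M'} {g : M' →ₗ[R] M''}

theorem of_linearEquiv (φ : M ≃ₗ[R] M') (h : ∀ z, φ (d z) = d' (φ z)) :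
    IsAcyclicSurjection d d' φ.toLinearMap where
  map_diff := h
  surjective := φ.surjective
  exact_ker z _ hz := ⟨0, map_zero _, by rw [map_zero, φ.map_eq_zero_iff.1 hz]⟩

theorem exists_cycle (h : IsAcyclicSurjection d d' f) (hd : d * d = 0) {x : M'} (hx : d' x = 0) :
    ∃ z, d z = 0 ∧ f z = x := by
  obtain ⟨y, rfl⟩ := h.surjective x
  obtain ⟨w, hw, hwy⟩ := h.exact_ker (d y) (DFunLike.congr_fun hd y) (by rw [h.map_diff, hx])
  exact ⟨y - w, by rw [map_sub, hwy, sub_self], by rw [map_sub, hw, sub_zero]⟩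

theorem exists_boundary (h : IsAcyclicSurjection d d' f) (hd : d * d = 0) {z : M} {x : M'}
    (hz : d z = 0) (hx : d' x = f z) : ∃ y, d y = z ∧ f y = x := by
  obtain ⟨y, rfl⟩ := h.surjective x
  have hdy : d (z - d y) = 0 := by
    rw [map_sub, hz, zero_sub, neg_eq_zero]
    exact DFunLike.congr_fun hd y
  obtain ⟨w, hw, hwz⟩ := h.exact_ker (z - d y) hdy (by rw [map_sub, h.map_diff, hx, sub_self])
  exact ⟨y + w, by rw [map_add, hwz, add_sub_cancel], by rw [map_add, hw, add_zero]⟩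

theorem comp (hg : IsAcyclicSurjection d' d'' g) (hf : IsAcyclicSurjection d d' f)
    (hd : d * d = 0) : IsAcyclicSurjection d d'' (g ∘ₗ f) where
  map_diff z := by rw [LinearMap.comp_apply, hf.map_diff, hg.map_diff, LinearMap.comp_apply]
  surjective := hg.surjective.comp hf.surjective
  exact_ker z hz hfz := by
    obtain ⟨x, hx, hxz⟩ := hg.exact_ker (f z) (by rw [← hf.map_diff, hz, map_zero]) hfz
    obtain ⟨y, hyz, hyx⟩ := hf.exists_boundary hd hz hxz
    exact ⟨y, by rw [LinearMap.comp_apply, hyx, hx], hyz⟩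

theorem neg (h : IsAcyclicSurjection d d' f) : IsAcyclicSurjection (-d) (-d') f where
  map_diff z := by simp only [LinearMap.neg_apply, map_neg, h.map_diff]
  surjective := h.surjective
  exact_ker z hz hfz := by
    obtain ⟨y, hy, hyz⟩ := h.exact_ker z (neg_eq_zero.1 hz) hfz
    exact ⟨-y, by rw [map_neg, hy, neg_zero], by rw [LinearMap.neg_apply, map_neg, neg_neg, hyz]⟩

end IsAcyclicSurjection

/-- The differential of the mapping cone of a chain map `f` from `(M, d)` to `(N, e)`. -/
def coneDiff (d : End R M) (f : M →ₗ[R] N) (e : End R N) : End R (M × N) :=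
  (d ∘ₗ LinearMap.fst R M N).prod (f ∘ₗ LinearMap.fst R M N - e ∘ₗ LinearMap.snd R M N)

@[simp]
theorem coneDiff_apply (d : End R M) (f : M →ₗ[R] N) (e : End R N) (z : M × N) :
    coneDiff d f e z = (d z.1, f z.1 - e z.2) := rfl

theorem coneDiff_mul_self {d : End R M} {f : M →ₗ[R] N} {e : End R N} (hd : d * d = 0)
    (he : e * e = 0) (hf : ∀ z, f (d z) = e (f z)) : coneDiff d f e * coneDiff d f e = 0 := by
  refine LinearMap.ext fun z => Prod.ext (LinearMap.congr_fun hd z.1) ?_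
  have he : e (e z.2) = 0 := LinearMap.congr_fun he z.2
  change f (d z.1) - e (f z.1 - e z.2) = 0
  rw [map_sub, hf, he, sub_zero, sub_self]

theorem IsAcyclicSurjection.prodMap {d : End R M} {d' : End R M'} {e : End R N} {e' : End R N'}
    {f : M →ₗ[R] N} {f' : M' →ₗ[R] N'} {g : M →ₗ[R] M'} {h : N →ₗ[R] N'}
    (hg : IsAcyclicSurjection d d' g) (hh : IsAcyclicSurjection e e' h)
    (hf : ∀ z, f (d z) = e (f z)) (hfg : ∀ z, h (f z) = f' (g z)) :
    IsAcyclicSurjection (coneDiff d f e) (coneDiff d' f' e') (g.prodMap h) where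
  map_diff z := by
    simp only [coneDiff_apply, LinearMap.prodMap_apply, map_sub, hg.map_diff, hh.map_diff, hfg]
  surjective := hg.surjective.prodMap hh.surjective
  exact_ker z hz hfz := by
    obtain ⟨hz₁, hz₂⟩ : d z.1 = 0 ∧ f z.1 - e z.2 = 0 := Prod.mk.inj hz
    obtain ⟨hfz₁, hfz₂⟩ : g z.1 = 0 ∧ h z.2 = 0 := Prod.mk.inj hfz
    obtain ⟨u, hu, huz⟩ := hg.exact_ker z.1 hz₁ hfz₁
    have hcycle : e (f u - z.2) = 0 := by rw [map_sub, ← hf, huz, hz₂]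
    have hker : h (f u - z.2) = 0 := by rw [map_sub, hfg, hu, map_zero, hfz₂, sub_zero]
    obtain ⟨v, hv, hvz⟩ := hh.exact_ker _ hcycle hker
    exact ⟨(u, v), Prod.ext hu hv, Prod.ext huz (by rw [coneDiff_apply, hvz, sub_sub_cancel])⟩

/-- The complex of a kink: from a complex `(M, d)` on which the algebra of a circle acts through
`x`, adding a positive kink gives a copy of `M` for the `A`-marker (`none`) and, for the
`B`-marker, a copy for either sign of the new circle. The differential splits off that circle. -/
def kinkDiff (d x : End R M) : End R (Option CircleSign → M) where
  toFun z
    | none => d (z none)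
    | some plus => z none - d (z (some plus))
    | some minus => x (z none) - d (z (some minus))
  map_add' z w := by
    ext (_ | _ | _) <;> simp only [Pi.add_apply, map_add, add_sub_add_comm]
  map_smul' r z := by
    ext (_ | _ | _) <;> simp only [Pi.smul_apply, map_smul, smul_sub, RingHom.id_apply]

/-- The action of the circle that ends up at the new kink: the old circle for the `A`-marker, the
new circle for the `B`-marker. -/
def kinkX (x : End R M) : End R (Option CircleSign → M) where
  toFun z
    | none => x (z none)
    | some plus => z (some minus)
    | some minus => 0
  map_add' z w := by
    ext (_ | _ | _) <;> simp only [Pi.add_apply, map_add, add_zero]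
  map_smul' r z := by
    ext (_ | _ | _) <;> simp only [Pi.smul_apply, map_smul, smul_zero, RingHom.id_apply]

/-- The retraction of the complex of a kink onto the complex without the kink. -/
def kinkRetract (x : End R M) : (Option CircleSign → M) →ₗ[R] M :=
  LinearMap.proj (some minus) - x ∘ₗ LinearMap.proj (φ := fun _ => M) (some plus)

section Kink

variable {d x y : End R M} (z : Option CircleSign → M)

@[simp] theorem kinkDiff_none : kinkDiff d x z none = d (z none) := rfl

@[simp] theorem kinkDiff_plus : kinkDiff d x z (some plus) = z none - d (z (some plus)) := rfl

@[simp] theorem kinkDiff_minus :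
    kinkDiff d x z (some minus) = x (z none) - d (z (some minus)) := rfl

@[simp] theorem kinkX_none : kinkX x z none = x (z none) := rfl

@[simp] theorem kinkX_plus : kinkX x z (some plus) = z (some minus) := rfl

@[simp] theorem kinkX_minus : kinkX x z (some minus) = 0 := rfl

@[simp] theorem kinkRetract_apply : kinkRetract x z = z (some minus) - x (z (some plus)) := rfl

theorem kinkX_mul_self (hx : x * x = 0) : kinkX x * kinkX x = 0 := by
  refine LinearMap.ext fun z => funext ?_
  rintro (_ | _ | _)
  · exact LinearMap.congr_fun hx (z none)
  · rfl
  · rfl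

theorem compLeft_mul_self (hx : x * x = 0) (I : Type*) : x.compLeft I * x.compLeft I = 0 :=
  LinearMap.ext fun z => funext fun i => LinearMap.congr_fun hx (z i)

theorem commute_kinkX_compLeft (h : Commute x y) : Commute (kinkX x) (y.compLeft _) := by
  refine LinearMap.ext fun z => funext ?_
  rintro (_ | _ | _)
  · exact LinearMap.congr_fun h (z none)
  · rfl
  · exact (map_zero y).symm

theorem kinkDiff_mul_self (hd : d * d = 0) (h : Commute d x) :
    kinkDiff d x * kinkDiff d x = 0 := by
  have hd z : d (d z) = 0 := LinearMap.congr_fun hd z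
  have h z : d (x z) = x (d z) := LinearMap.congr_fun h z
  refine LinearMap.ext fun z => funext ?_
  rintro (_ | _ | _) <;> simp [hd, h]

theorem commute_kinkDiff_kinkX (hx : x * x = 0) (h : Commute d x) :
    Commute (kinkDiff d x) (kinkX x) := by
  have hx z : x (x z) = 0 := LinearMap.congr_fun hx z
  have h z : d (x z) = x (d z) := LinearMap.congr_fun h z
  refine LinearMap.ext fun z => funext ?_
  rintro (_ | _ | _) <;> simp [hx, h]

theorem commute_kinkDiff_compLeft (hd : Commute d y) (hx : Commute x y) :
    Commute (kinkDiff d x) (y.compLeft _) := by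
  have hd z : d (y z) = y (d z) := LinearMap.congr_fun hd z
  have hx z : x (y z) = y (x z) := LinearMap.congr_fun hx z
  refine LinearMap.ext fun z => funext ?_
  rintro (_ | _ | _) <;> simp [hd, hx]

theorem isAcyclicSurjection_kinkRetract (h : Commute d x) :
    IsAcyclicSurjection (kinkDiff d x) (-d) (kinkRetract x) where
  map_diff z := by
    have h : d (x (z (some plus))) = x (d (z (some plus))) := LinearMap.congr_fun h _
    simp [h]
  surjective u := ⟨Function.update 0 (some minus) u, by simp⟩
  exact_ker z hz hrz := by
    have hplus : z none = d (z (some plus)) := sub_eq_zero.1 (congrFun hz (some plus))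
    have hminus : z (some minus) = x (z (some plus)) := sub_eq_zero.1 hrz
    refine ⟨Function.update 0 none (z (some plus)), by simp, funext ?_⟩
    rintro (_ | _ | _) <;> simp [hplus, hminus]

theorem kinkRetract_kinkX (hx : x * x = 0) : kinkRetract x (kinkX x z) = -x (kinkRetract x z) := by
  have hx : x (x (z (some plus))) = 0 := LinearMap.congr_fun hx _
  simp [hx]

theorem kinkRetract_compLeft (h : Commute x y) :
    kinkRetract x (y.compLeft _ z) = y (kinkRetract x z) := by
  have h : x (y (z (some plus))) = y (x (z (some plus))) := LinearMap.congr_fun h _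
  simp [h]

end Kink

end Algebra

/-- The generators of the complex of a row of `m` positive kinks on an arc closed up to a circle:
the sign of the base circle and, for every kink, `none` for an `A`-marker, or the sign of the new
circle for a `B`-marker. -/
def ArcWord : ℕ → Type
  | 0 => CircleSign
  | m + 1 => Option CircleSign × ArcWord m

/-- The generators of the complex of `T(2, n)`. If the last crossing has an `A`-marker, they are
those of `T(2, n - 1)`; if it has a `B`-marker, the remaining crossings form a row of kinks. -/
def TorusWord : ℕ → Type
  | 0 => CircleSign × CircleSign
  | n + 1 => TorusWord n ⊕ ArcWord n

/-- Currying of the chains on a row of kinks with respect to the last kink. -/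
def arcCurry (m : ℕ) : (ArcWord (m + 1) → ℤ) ≃ₗ[ℤ] (Option CircleSign → ArcWord m → ℤ) :=
  LinearEquiv.curry ℤ ℤ (Option CircleSign) (ArcWord m)

/-- The splitting of the chains on `T(2, n + 1)` by the marker of the last crossing. -/
def torusSplit (n : ℕ) : (TorusWord (n + 1) → ℤ) ≃ₗ[ℤ] (TorusWord n → ℤ) × (ArcWord n → ℤ) :=
  LinearEquiv.sumArrowLequivProdArrow (TorusWord n) (ArcWord n) ℤ ℤ

/-- Multiplication by `X` in `ℤ[X]/(X²)`, where `minus` stands for `1` and `plus` for `X`. -/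
def signX : End ℤ (CircleSign → ℤ) where
  toFun z
    | plus => z minus
    | minus => 0
  map_add' z w := by ext (_ | _) <;> simp only [Pi.add_apply, add_zero]
  map_smul' r z := by ext (_ | _) <;> simp only [Pi.smul_apply, smul_zero, RingHom.id_apply]

/-- The action of the circle below a row of kinks, at the end of the arc. -/
def lastX : ∀ m, End ℤ (ArcWord m → ℤ)
  | 0 => signX
  | m + 1 => (arcCurry m).symm.conjRingEquiv (kinkX (lastX m))

/-- The action of the base circle of a row of kinks. -/
def baseX : ∀ m, End ℤ (ArcWord m → ℤ)
  | 0 => signX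
  | m + 1 => (arcCurry m).symm.conjRingEquiv ((baseX m).compLeft (Option CircleSign))

/-- The differential of a row of kinks. -/
def arcDiff : ∀ m, End ℤ (ArcWord m → ℤ)
  | 0 => 0
  | m + 1 => (arcCurry m).symm.conjRingEquiv (kinkDiff (arcDiff m) (lastX m))

/-- The retraction that removes all kinks of a row. -/
def arcAug : ∀ m, (ArcWord m → ℤ) →ₗ[ℤ] (CircleSign → ℤ)
  | 0 => LinearMap.id
  | m + 1 => arcAug m ∘ₗ kinkRetract (lastX m) ∘ₗ (arcCurry m).toLinearMap

/-- Multiplication `ℤ[X]/(X²) ⊗ ℤ[X]/(X²) → ℤ[X]/(X²)`. -/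
def signMul : (CircleSign × CircleSign → ℤ) →ₗ[ℤ] (CircleSign → ℤ) where
  toFun z
    | plus => z (plus, minus) + z (minus, plus)
    | minus => z (minus, minus)
  map_add' z w := by ext (_ | _) <;> simp only [Pi.add_apply, add_add_add_comm]
  map_smul' r z := by ext (_ | _) <;> simp only [Pi.smul_apply, smul_add, RingHom.id_apply]

/-- The change of the marker of a further crossing of `T(2, n + 1)` from `A` to `B`. It merges the
two circles if there are two; otherwise it splits off a new circle from the one that passes the new
crossing, the base circle of the resulting row of kinks. -/
def closeUp : ∀ n, (TorusWord n → ℤ) →ₗ[ℤ] (ArcWord n → ℤ)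
  | 0 => signMul
  | n + 1 =>
    { toFun := fun z => (arcCurry n).symm fun
        | none => closeUp n (torusSplit n z).1
        | some plus => (torusSplit n z).2
        | some minus => baseX n (torusSplit n z).2
      map_add' := fun z w => by
        rw [← map_add]
        congr 1
        ext (_ | _ | _) <;> simp only [map_add, Prod.fst_add, Prod.snd_add, Pi.add_apply]
      map_smul' := fun r z => by
        rw [← map_smul]
        congr 1
        ext (_ | _ | _) <;>
          simp only [map_smul, Prod.smul_fst, Prod.smul_snd, Pi.smul_apply, RingHom.id_apply] }

/-- The differential of the complex of `T(2, n)`, an iterated mapping cone. -/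
def torusDiff : ∀ n, End ℤ (TorusWord n → ℤ)
  | 0 => 0
  | n + 1 => (torusSplit n).symm.conjRingEquiv (coneDiff (torusDiff n) (closeUp n) (arcDiff n))

theorem signX_mul_self : signX * signX = 0 := by
  refine LinearMap.ext fun z => funext ?_
  rintro (_ | _) <;> rfl

theorem lastX_mul_self : ∀ m, lastX m * lastX m = 0
  | 0 => signX_mul_self
  | m + 1 => by rw [lastX, ← map_mul, kinkX_mul_self (lastX_mul_self m), map_zero]

theorem baseX_mul_self : ∀ m, baseX m * baseX m = 0
  | 0 => signX_mul_self
  | m + 1 => by rw [baseX, ← map_mul, compLeft_mul_self (baseX_mul_self m), map_zero]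

theorem commute_lastX_baseX : ∀ m, Commute (lastX m) (baseX m)
  | 0 => Commute.refl signX
  | m + 1 => (commute_kinkX_compLeft (commute_lastX_baseX m)).map _

theorem commute_arcDiff_lastX : ∀ m, Commute (arcDiff m) (lastX m)
  | 0 => Commute.zero_left _
  | m + 1 => (commute_kinkDiff_kinkX (lastX_mul_self m) (commute_arcDiff_lastX m)).map _

theorem commute_arcDiff_baseX : ∀ m, Commute (arcDiff m) (baseX m)
  | 0 => Commute.zero_left _
  | m + 1 =>
    (commute_kinkDiff_compLeft (commute_arcDiff_baseX m) (commute_lastX_baseX m)).map _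

theorem arcDiff_mul_self : ∀ m, arcDiff m * arcDiff m = 0
  | 0 => mul_zero _
  | m + 1 => by
    rw [arcDiff, ← map_mul, kinkDiff_mul_self (arcDiff_mul_self m) (commute_arcDiff_lastX m),
      map_zero]

theorem isAcyclicSurjection_arcAug : ∀ m, IsAcyclicSurjection (arcDiff m) 0 (arcAug m)
  | 0 => .of_linearEquiv (LinearEquiv.refl ℤ _) fun _ => rfl
  | m + 1 => by
    have hcurry : IsAcyclicSurjection (arcDiff (m + 1)) (kinkDiff (arcDiff m) (lastX m))
        (arcCurry m).toLinearMap := .of_linearEquiv _ fun _ => rfl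
    have haug := (isAcyclicSurjection_arcAug m).neg
    rw [neg_zero] at haug
    have hkink := isAcyclicSurjection_kinkRetract (commute_arcDiff_lastX m)
    exact haug.comp (hkink.comp hcurry (arcDiff_mul_self _)) (arcDiff_mul_self _)

theorem arcAug_lastX : ∀ m (z : ArcWord m → ℤ),
    arcAug m (lastX m z) = (-1 : ℤ) ^ m • signX (arcAug m z)
  | 0, _ => (one_smul ℤ _).symm
  | m + 1, z => by
    change arcAug m (kinkRetract (lastX m) (kinkX (lastX m) (arcCurry m z))) =
      _ • signX (arcAug m (kinkRetract (lastX m) (arcCurry m z)))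
    rw [kinkRetract_kinkX _ (lastX_mul_self m), map_neg, arcAug_lastX m, pow_succ, mul_neg_one,
      neg_smul]

theorem arcAug_baseX : ∀ m (z : ArcWord m → ℤ), arcAug m (baseX m z) = signX (arcAug m z)
  | 0, _ => rfl
  | m + 1, z => by
    change arcAug m (kinkRetract (lastX m) ((baseX m).compLeft _ (arcCurry m z))) =
      signX (arcAug m (kinkRetract (lastX m) (arcCurry m z)))
    rw [kinkRetract_compLeft _ (commute_lastX_baseX m), arcAug_baseX m]

theorem lastX_closeUp : ∀ n (z : TorusWord n → ℤ),
    lastX n (closeUp n z) = baseX n (closeUp n z)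
  | 0, _ => rfl
  | n + 1, z => by
    refine (arcCurry n).injective (funext ?_)
    rintro (_ | _ | _)
    · exact lastX_closeUp n (torusSplit n z).1
    · rfl
    · exact (LinearMap.congr_fun (baseX_mul_self n) (torusSplit n z).2).symm

theorem closeUp_torusDiff : ∀ n (z : TorusWord n → ℤ),
    closeUp n (torusDiff n z) = arcDiff n (closeUp n z)
  | 0, _ => map_zero signMul
  | n + 1, z => by
    refine (arcCurry n).injective (funext ?_)
    rintro (_ | _ | _)
    · exact closeUp_torusDiff n (torusSplit n z).1
    · rfl
    · change baseX n (closeUp n (torusSplit n z).1 - arcDiff n (torusSplit n z).2) =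
        lastX n (closeUp n (torusSplit n z).1) - arcDiff n (baseX n (torusSplit n z).2)
      rw [map_sub, lastX_closeUp]
      congr 1
      exact (LinearMap.congr_fun (commute_arcDiff_baseX n) _).symm

theorem torusDiff_mul_self : ∀ n, torusDiff n * torusDiff n = 0
  | 0 => mul_zero _
  | n + 1 => by
    rw [torusDiff, ← map_mul, coneDiff_mul_self (torusDiff_mul_self n) (arcDiff_mul_self n)
      (closeUp_torusDiff n), map_zero]

theorem arcAug_closeUp_succ (n : ℕ) (z : TorusWord (n + 1) → ℤ) :
    arcAug (n + 1) (closeUp (n + 1) z) =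
      (1 - (-1) ^ n : ℤ) • signX (arcAug n (torusSplit n z).2) := by
  change arcAug n (baseX n _ - lastX n _) = _
  rw [map_sub, arcAug_baseX, arcAug_lastX, sub_smul, one_smul]
  rfl

/-- The generators of the reduced complex of `T(2, n)`: the two circles of the state with only
`A`-markers, and one circle for every crossing `k`, which is what the row of kinks below the
crossing `k` retracts to. -/
abbrev ReducedWord (n : ℕ) : Type := (CircleSign × CircleSign) ⊕ Fin n × CircleSign

/-- The differential of the reduced complex of `T(2, n)`: the multiplication
`ℤ[X]/(X²) ⊗ ℤ[X]/(X²) → ℤ[X]/(X²)` followed alternatingly by `0` and `2X`. -/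
def reducedDiff (n : ℕ) : End ℤ (ReducedWord n → ℤ) where
  toFun x
    | Sum.inl _ => 0
    | Sum.inr (⟨0, _⟩, ε) => signMul (fun p => x (Sum.inl p)) ε
    | Sum.inr (⟨k + 1, hk⟩, ε) =>
      (1 - (-1) ^ k) * signX (fun ε' => x (Sum.inr (⟨k, Nat.lt_of_succ_lt hk⟩, ε'))) ε
  map_add' x y := by
    ext (_ | ⟨⟨_ | k, hk⟩, ε⟩)
    · rfl
    · exact congrFun (map_add signMul _ _) ε
    · exact (congrArg (_ * ·) (congrFun (map_add signX _ _) ε)).trans (mul_add _ _ _)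
  map_smul' r x := by
    ext (_ | ⟨⟨_ | k, hk⟩, ε⟩)
    · exact (mul_zero r).symm
    · exact congrFun (map_smul signMul r _) ε
    · exact (congrArg (_ * ·) (congrFun (map_smul signX r _) ε)).trans (mul_left_comm _ _ _)

/-- The chains on the reduced complex of `T(2, n + 1)`, split by whether they belong to the last
crossing. -/
def reducedJoin (n : ℕ) :
    ((ReducedWord n → ℤ) × (CircleSign → ℤ)) ≃ₗ[ℤ] (ReducedWord (n + 1) → ℤ) where
  toFun z
    | Sum.inl p => z.1 (Sum.inl p)
    | Sum.inr (k, ε) => Fin.lastCases (z.2 ε) (fun k => z.1 (Sum.inr (k, ε))) k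
  invFun x := (fun
    | Sum.inl p => x (Sum.inl p)
    | Sum.inr (k, ε) => x (Sum.inr (k.castSucc, ε)), fun ε => x (Sum.inr (Fin.last n, ε)))
  map_add' z w := by
    ext (_ | ⟨k, ε⟩)
    · rfl
    · induction k using Fin.lastCases <;> simp
  map_smul' r z := by
    ext (_ | ⟨k, ε⟩)
    · rfl
    · induction k using Fin.lastCases <;> simp
  left_inv z := by
    ext i
    · rcases i with _ | ⟨k, ε⟩
      · rfl
      · exact Fin.lastCases_castSucc (motive := fun _ => ℤ) ..
    · exact Fin.lastCases_last (motive := fun _ => ℤ) ..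
  right_inv x := by
    ext (_ | ⟨k, ε⟩)
    · rfl
    · induction k using Fin.lastCases <;> simp

@[simp]
theorem reducedJoin_castSucc {n : ℕ} (z : (ReducedWord n → ℤ) × (CircleSign → ℤ)) (k : Fin n)
    (ε : CircleSign) : reducedJoin n z (Sum.inr (k.castSucc, ε)) = z.1 (Sum.inr (k, ε)) :=
  Fin.lastCases_castSucc (motive := fun _ => ℤ) ..

@[simp]
theorem reducedJoin_last {n : ℕ} (z : (ReducedWord n → ℤ) × (CircleSign → ℤ))
    (ε : CircleSign) : reducedJoin n z (Sum.inr (Fin.last n, ε)) = z.2 ε :=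
  Fin.lastCases_last (motive := fun _ => ℤ) ..

/-- The last component of the differential of the reduced complex of `T(2, n + 1)`. -/
def reducedTop : ∀ n, (ReducedWord n → ℤ) →ₗ[ℤ] (CircleSign → ℤ)
  | 0 => signMul ∘ₗ LinearMap.funLeft ℤ ℤ Sum.inl
  | n + 1 => (1 - (-1) ^ n : ℤ) • signX ∘ₗ LinearMap.funLeft ℤ ℤ fun ε => Sum.inr (Fin.last n, ε)

theorem reducedDiff_reducedJoin (n : ℕ) (z : (ReducedWord n → ℤ) × (CircleSign → ℤ)) :
    reducedDiff (n + 1) (reducedJoin n z) =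
      reducedJoin n (coneDiff (reducedDiff n) (reducedTop n) 0 z) := by
  ext (_ | ⟨k, ε⟩)
  · rfl
  induction k using Fin.lastCases with
  | cast k =>
    rw [reducedJoin_castSucc]
    rcases k with ⟨_ | k, hk⟩
    · rfl
    · refine congrArg (_ * signX · ε) (funext fun ε' => ?_)
      exact reducedJoin_castSucc z ⟨k, Nat.lt_of_succ_lt hk⟩ ε'
  | last =>
    rw [reducedJoin_last, coneDiff_apply, LinearMap.zero_apply, sub_zero]
    rcases n with _ | n
    · rfl
    · refine congrArg (_ * signX · ε) (funext fun ε' => ?_)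
      exact reducedJoin_castSucc z (Fin.last n) ε'

/-- The generators of the reduced complex of `T(2, 0)`. -/
def reducedZero : (CircleSign × CircleSign → ℤ) ≃ₗ[ℤ] (ReducedWord 0 → ℤ) :=
  LinearEquiv.funCongrLeft ℤ ℤ (Equiv.sumEmpty _ _)

/-- The retraction of the complex of `T(2, n)` onto the reduced complex. -/
def torusAug : ∀ n, (TorusWord n → ℤ) →ₗ[ℤ] (ReducedWord n → ℤ)
  | 0 => reducedZero.toLinearMap
  | n + 1 => (reducedJoin n).toLinearMap ∘ₗ ((torusAug n).prodMap (arcAug n)) ∘ₗ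
      (torusSplit n).toLinearMap

theorem arcAug_closeUp : ∀ n (z : TorusWord n → ℤ),
    arcAug n (closeUp n z) = reducedTop n (torusAug n z)
  | 0, _ => rfl
  | n + 1, z => by
    rw [arcAug_closeUp_succ]
    refine congrArg (_ • signX ·) (funext fun ε => ?_)
    exact (reducedJoin_last ((torusAug n).prodMap (arcAug n) (torusSplit n z)) ε).symm

theorem isAcyclicSurjection_torusAug : ∀ n,
    IsAcyclicSurjection (torusDiff n) (reducedDiff n) (torusAug n)
  | 0 => .of_linearEquiv reducedZero fun _ => by
    ext (_ | ⟨k, _⟩)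
    · rfl
    · exact k.elim0
  | n + 1 => by
    have hsplit : IsAcyclicSurjection (torusDiff (n + 1))
        (coneDiff (torusDiff n) (closeUp n) (arcDiff n)) (torusSplit n).toLinearMap :=
      .of_linearEquiv _ fun _ => rfl
    have hcone := (isAcyclicSurjection_torusAug n).prodMap (isAcyclicSurjection_arcAug n)
      (closeUp_torusDiff n) (arcAug_closeUp n)
    have hjoin := IsAcyclicSurjection.of_linearEquiv (reducedJoin n)
      fun z => (reducedDiff_reducedJoin n z).symm
    exact hjoin.comp (hcone.comp hsplit (torusDiff_mul_self (n + 1))) (torusDiff_mul_self (n + 1))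

section Grading

variable {R Γ I J : Type*} [Ring R] {degI : I → Γ} {degJ : J → Γ} {p δ : Γ}

/-- The family of coefficients `z` is supported on indices of degree `p`. -/
def IsHomogeneous (degI : I → Γ) (p : Γ) (z : I → R) : Prop :=
  ∀ i, degI i ≠ p → z i = 0

open Classical in
/-- The homogeneous component of degree `p`. -/
noncomputable def component (degI : I → Γ) (p : Γ) (z : I → R) : I → R :=
  fun i => if degI i = p then z i else 0

theorem isHomogeneous_component (z : I → R) : IsHomogeneous degI p (component degI p z) :=
  fun _ hi => if_neg hi

theorem IsHomogeneous.component_eq {z : I → R} (hz : IsHomogeneous degI p z) :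
    component degI p z = z := by
  classical exact funext fun i => ite_eq_left_iff.2 fun hi => (hz i hi).symm

/-- The homology of the differential `e` in degree `p` is isomorphic to `G`: some homomorphism to
`G` is surjective on the cycles of degree `p` and vanishes exactly on the boundaries among them. -/
def HasHomology (e : (I → R) →ₗ[R] (I → R)) (degI : I → Γ) (p : Γ) (G : Type*) [AddCommGroup G]
    [Module R G] : Prop :=
  ∃ φ : (I → R) →ₗ[R] G, (∀ g, ∃ x, IsHomogeneous degI p x ∧ e x = 0 ∧ φ x = g) ∧
    ∀ x, IsHomogeneous degI p x → e x = 0 → (φ x = 0 ↔ ∃ y, e y = x)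

theorem IsHomogeneous.eq_single [DecidableEq I] {z : I → R} (hz : IsHomogeneous degI p z) {i : I}
    (hi : ∀ j, degI j = p → j = i) : z = Pi.single i (z i) := by
  funext j
  by_cases hj : degI j = p
  · rw [hi j hj, Pi.single_eq_same]
  · rw [hz j hj, Pi.single_apply]
    split_ifs with h
    · rw [← h, hz j hj]
    · rfl

theorem isHomogeneous_single [DecidableEq I] (i : I) (r : R) :
    IsHomogeneous degI (degI i) (Pi.single i r) :=
  fun _ hj => (Pi.single_apply i r _).trans (if_neg fun h => hj (congrArg degI h))

theorem HasHomology.of_forall_boundary {e : (I → R) →ₗ[R] (I → R)}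
    (h : ∀ z, IsHomogeneous degI p z → e z = 0 → ∃ y, e y = z) :
    HasHomology e degI p PUnit :=
  ⟨0, fun _ => ⟨0, fun _ _ => rfl, map_zero e, rfl⟩, fun z hz hez => iff_of_true rfl (h z hz hez)⟩

theorem HasHomology.of_unique [DecidableEq I] {e : (I → R) →ₗ[R] (I → R)} {G : Type*}
    [AddCommGroup G] [Module R G] {i : I} (hi : ∀ j, degI j = degI i → j = i)
    (he : ∀ r, e (Pi.single i r) = 0) (ψ : R →ₗ[R] G) (hψ : Function.Surjective ψ)
    (hker : ∀ r, ψ r = 0 ↔ ∃ y, e y = Pi.single i r) : HasHomology e degI (degI i) G := by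
  refine ⟨ψ ∘ₗ LinearMap.proj i, fun g => ?_, fun z hz _ => ?_⟩
  · obtain ⟨r, rfl⟩ := hψ g
    refine ⟨_, isHomogeneous_single i r, he r, congrArg ψ ?_⟩
    exact (Pi.single_apply i r i).trans (if_pos rfl)
  · rw [LinearMap.comp_apply, LinearMap.proj_apply, hker, ← hz.eq_single hi]

variable [AddGroup Γ]

/-- The linear map `f` raises degrees by `δ`: the value of `f z` at an index of degree `q` depends
only on the part of `z` in degree `q - δ`. -/
def RaisesDegree (degI : I → Γ) (degJ : J → Γ) (δ : Γ) (f : (I → R) →ₗ[R] (J → R)) : Prop :=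
  ∀ z j, (∀ i, degI i + δ = degJ j → z i = 0) → f z j = 0

theorem RaisesDegree.comp {K : Type*} {degK : K → Γ} {δ' : Γ} {g : (J → R) →ₗ[R] (K → R)}
    {f : (I → R) →ₗ[R] (J → R)} (hg : RaisesDegree degJ degK δ' g)
    (hf : RaisesDegree degI degJ δ f) : RaisesDegree degI degK (δ + δ') (g ∘ₗ f) :=
  fun z k hz => hg _ k fun j hj => hf z j fun i hi => hz i (by rw [← hj, ← hi, add_assoc])

theorem RaisesDegree.map_component {f : (I → R) →ₗ[R] (J → R)} (hf : RaisesDegree degI degJ δ f)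
    (p : Γ) (z : I → R) : f (component degI p z) = component degJ (p + δ) (f z) := by
  funext j
  by_cases hj : degJ j = p + δ
  · rw [component, if_pos hj, ← sub_eq_zero, ← Pi.sub_apply, ← map_sub]
    refine hf _ j fun i hi => ?_
    rw [Pi.sub_apply, component, if_pos (add_right_cancel (hi.trans hj)), sub_self]
  · rw [component, if_neg hj]
    refine hf _ j fun i hi => if_neg fun hp => hj ?_
    rw [← hi, hp]

theorem RaisesDegree.isHomogeneous {f : (I → R) →ₗ[R] (J → R)} (hf : RaisesDegree degI degJ δ f)
    {z : I → R} (hz : IsHomogeneous degI p z) : IsHomogeneous degJ (p + δ) (f z) := by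
  rw [← hz.component_eq, hf.map_component]
  exact isHomogeneous_component _

end Grading

end Khovanov

namespace PDCode

open Khovanov

variable {X E : Type}

theorem sigma_eq_sum {D : PDCode X E} [Fintype X] (S : D.EnhancedState) :
    sigma S = ∑ v, if S.1 v = Marker.A then 1 else -1 := by
  have h : ∀ v, (if S.1 v = Marker.A then 1 else -1 : ℤ) =
      (if S.1 v = Marker.A then 1 else 0) - if S.1 v = Marker.B then 1 else 0 :=
    fun v => by rcases S.1 v with _ | _ <;> rfl
  simp only [h, sigma, Finset.sum_sub_distrib, Finset.sum_boole, Nat.card_eq_fintype_card,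
    Fintype.card_subtype]

theorem IncidentAt.sigma_eq [Finite X] {D : PDCode X E} {v : X} {S S' : D.EnhancedState}
    (h : D.IncidentAt v S S') : sigma S' = sigma S - 2 := by
  classical
  cases nonempty_fintype X
  obtain ⟨hA, hB, hne, -, -⟩ := h
  rw [sigma_eq_sum, sigma_eq_sum, ← Finset.add_sum_erase _ _ (Finset.mem_univ v),
    ← Finset.add_sum_erase _ _ (Finset.mem_univ v),
    Finset.sum_congr rfl fun w hw => by rw [hne w (Finset.ne_of_mem_erase hw)], hA, hB]
  simp only [if_true, reduceCtorEq, if_false]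
  ring

/-- The bidegree `(a, b)` of an enhanced state. -/
noncomputable def bidegree {D : PDCode X E} (S : D.EnhancedState) : ℤ × ℤ :=
  (sigma S, sigma S + 2 * tau S)

theorem bidegree_eq_iff {D : PDCode X E} {S : D.EnhancedState} {a b : ℤ} :
    bidegree S = (a, b) ↔ a = sigma S ∧ b = sigma S + 2 * tau S := by
  rw [bidegree, Prod.mk.injEq, eq_comm (a := a), eq_comm (a := b)]

theorem BidegreeState.bidegree_eq {D : PDCode X E} {a b : ℤ} (S : D.BidegreeState a b) :
    bidegree S.1 = (a, b) :=
  bidegree_eq_iff.2 S.2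

section Extend

variable (D : PDCode X E) {a b : ℤ}

open Classical in
/-- A chain of bidegree `(a, b)` as a family of coefficients of all enhanced states. -/
noncomputable def extendChain (a b : ℤ) : D.Chain a b →ₗ[ℤ] (D.EnhancedState → ℤ) where
  toFun x S := if h : bidegree S = (a, b) then x ⟨S, bidegree_eq_iff.1 h⟩ else 0
  map_add' x y := by
    funext S
    by_cases h : bidegree S = (a, b)
    · simp only [h, dif_pos, Pi.add_apply]
      rfl
    · simp only [h, dif_neg, not_false_eq_true, Pi.add_apply, add_zero]
  map_smul' r x := by
    funext S
    by_cases h : bidegree S = (a, b)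
    · simp only [h, dif_pos, Pi.smul_apply, RingHom.id_apply]
      rfl
    · simp only [h, dif_neg, not_false_eq_true, Pi.smul_apply, smul_zero]

@[simp]
theorem extendChain_coe (x : D.Chain a b) (S : D.BidegreeState a b) :
    D.extendChain a b x S.1 = x S :=
  dif_pos S.bidegree_eq

theorem isHomogeneous_extendChain (x : D.Chain a b) :
    IsHomogeneous bidegree (a, b) (D.extendChain a b x) :=
  fun _ hS => dif_neg hS

theorem extendChain_injective : Function.Injective (D.extendChain a b) := by
  intro x y h
  ext S
  rw [← extendChain_coe, h, extendChain_coe]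

theorem exists_extendChain_eq [Finite X] [Finite E] {z : D.EnhancedState → ℤ}
    (hz : IsHomogeneous bidegree (a, b) z) :
    ∃ x, D.extendChain a b x = z := by
  refine ⟨Finsupp.equivFunOnFinite.symm fun S => z S.1, funext fun S => ?_⟩
  by_cases hS : bidegree S = (a, b)
  · exact extendChain_coe D _ ⟨S, bidegree_eq_iff.1 hS⟩
  · rw [hz S hS, isHomogeneous_extendChain D _ S hS]

end Extend

section TotalComplex

variable [Fintype X] [LinearOrder X] [Finite E] (D : PDCode X E) {a b : ℤ}

noncomputable instance : Fintype D.EnhancedState := Fintype.ofFinite _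

/-- The differential on the direct sum of all chain groups. -/
noncomputable def totalDiff : Module.End ℤ (D.EnhancedState → ℤ) :=
  (Matrix.of D.coefficient).vecMulLinear

theorem totalDiff_apply (z : D.EnhancedState → ℤ) (S' : D.EnhancedState) :
    D.totalDiff z S' = ∑ S, z S * D.coefficient S S' := rfl

theorem raisesDegree_totalDiff : RaisesDegree bidegree bidegree (-2, 0) D.totalDiff := by
  classical
  refine fun z S' hz => Finset.sum_eq_zero fun S _ => ?_
  by_cases h : ∃ v, D.IncidentAt v S S'
  · obtain ⟨v, hv⟩ := h
    have htau : tau S' = tau S + 1 := hv.2.2.2.1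
    refine mul_eq_zero_of_left (hz S (Prod.ext ?_ ?_)) _
    · exact hv.sigma_eq.symm
    · simp only [bidegree, Prod.mk_add_mk, hv.sigma_eq, htau]
      ring
  · exact mul_eq_zero_of_right _ (Finset.sum_eq_zero fun v _ => if_neg fun hv => h ⟨v, hv⟩)

theorem differential_apply {a' : ℤ} (x : D.Chain a b) (S' : D.BidegreeState a' b) :
    D.differential a a' b x S' = ∑ S : D.BidegreeState a b, x S * D.coefficient S.1 S'.1 := by
  classical
  simp [differential, Finsupp.linearCombination_apply, Finsupp.sum_fintype,
    Finsupp.finsetSum_apply, Finsupp.single_apply]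

theorem extendChain_differential {a' : ℤ} (h : a = a' + 2) (x : D.Chain a b) :
    D.extendChain a' b (D.differential a a' b x) = D.totalDiff (D.extendChain a b x) := by
  classical
  have hx := D.isHomogeneous_extendChain x
  funext S'
  by_cases hS' : bidegree S' = (a', b)
  · obtain ⟨S', rfl⟩ : ∃ T : D.BidegreeState a' b, T.1 = S' := ⟨⟨S', bidegree_eq_iff.1 hS'⟩, rfl⟩
    rw [extendChain_coe, differential_apply, totalDiff_apply]
    refine Fintype.sum_of_injective (fun S : D.BidegreeState a b => S.1)
      Subtype.val_injective _ _ (fun S hS => ?_) fun S => by rw [extendChain_coe]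
    refine mul_eq_zero_of_left (hx S fun hdeg => hS ?_) _
    exact ⟨⟨S, bidegree_eq_iff.1 hdeg⟩, rfl⟩
  · rw [D.isHomogeneous_extendChain _ S' hS']
    refine (D.raisesDegree_totalDiff.isHomogeneous hx S' fun h' => hS' ?_).symm
    rw [h', h]
    simp

theorem differential_eq_zero_iff (x : D.Chain a b) :
    D.differential a (a - 2) b x = 0 ↔ D.totalDiff (D.extendChain a b x) = 0 := by
  rw [← extendChain_differential D (sub_add_cancel a 2).symm,
    map_eq_zero_iff _ D.extendChain_injective]

theorem exists_differential_eq_iff (x : D.Chain a b) :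
    (∃ y, D.differential (a + 2) a b y = x) ↔ ∃ z, D.totalDiff z = D.extendChain a b x := by
  constructor
  · rintro ⟨y, rfl⟩
    exact ⟨_, (D.extendChain_differential rfl y).symm⟩
  · rintro ⟨z, hz⟩
    obtain ⟨y, hy⟩ := D.exists_extendChain_eq (isHomogeneous_component (p := (a + 2, b)) z)
    refine ⟨y, D.extendChain_injective ?_⟩
    rw [extendChain_differential D rfl, hy, D.raisesDegree_totalDiff.map_component, hz]
    convert (D.isHomogeneous_extendChain x).component_eq using 2
    simp

theorem nonempty_khovanovHomology_equiv {I G : Type*} [AddCommGroup G] {deg : I → ℤ × ℤ}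
    {e : Module.End ℤ (I → ℤ)} {f : (D.EnhancedState → ℤ) →ₗ[ℤ] (I → ℤ)}
    (hf : IsAcyclicSurjection D.totalDiff e f) (hd : D.totalDiff * D.totalDiff = 0)
    (hdeg : RaisesDegree bidegree deg 0 f) (hG : HasHomology e deg (a, b) G) :
    Nonempty (D.KhovanovHomology a b ≃+ G) := by
  obtain ⟨φ, hsurj, hker⟩ := hG
  let Φ : LinearMap.ker (D.differential a (a - 2) b) →ₗ[ℤ] G :=
    φ ∘ₗ f ∘ₗ D.extendChain a b ∘ₗ Submodule.subtype _
  have hcycle (x : LinearMap.ker (D.differential a (a - 2) b)) :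
      D.totalDiff (D.extendChain a b x) = 0 := (D.differential_eq_zero_iff x.1).1 x.2
  have hΦsurj : Function.Surjective Φ := fun g => by
    obtain ⟨x, hx, hex, rfl⟩ := hsurj g
    obtain ⟨z, hz, rfl⟩ := hf.exists_cycle hd hex
    obtain ⟨y, hy⟩ := D.exists_extendChain_eq (isHomogeneous_component (p := (a, b)) z)
    have hdy : D.differential a (a - 2) b y = 0 := by
      rw [differential_eq_zero_iff, hy, D.raisesDegree_totalDiff.map_component, hz]
      exact funext fun _ => ite_self _
    refine ⟨⟨y, hdy⟩, congrArg φ ?_⟩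
    change f (D.extendChain a b y) = f z
    rw [hy, hdeg.map_component, add_zero, hx.component_eq]
  have hΦker : (LinearMap.range (D.differential (a + 2) a b)).submoduleOf _ =
      LinearMap.ker Φ := by
    ext x
    have hhom : IsHomogeneous deg (a, b) (f (D.extendChain a b x)) := by
      simpa only [add_zero] using hdeg.isHomogeneous (D.isHomogeneous_extendChain x.1)
    have hex : e (f (D.extendChain a b x)) = 0 := by rw [← hf.map_diff, hcycle, map_zero]
    refine (D.exists_differential_eq_iff x.1).trans (Iff.trans ?_ (hker _ hhom hex).symm)
    constructor
    · rintro ⟨z, hz⟩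
      exact ⟨f z, by rw [← hf.map_diff, hz]⟩
    · rintro ⟨y, hy⟩
      obtain ⟨z, hz, -⟩ := hf.exists_boundary hd (hcycle x) hy
      exact ⟨z, hz⟩
  have equiv := (Submodule.quotEquivOfEq _ _ hΦker).trans (Φ.quotKerEquivOfSurjective hΦsurj)
  exact ⟨equiv.toAddEquiv⟩

end TotalComplex

end PDCode

namespace Khovanov

open CircleSign Module

/-- The contribution of the sign of a circle to `τ`. -/
def signVal : CircleSign → ℤ
  | plus => 1
  | minus => -1

/-- The contribution of a letter to `σ`. -/
def letterSigma : Option CircleSign → ℤ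
  | none => 1
  | some _ => -1

/-- The contribution of a letter to `τ`. -/
def letterTau : Option CircleSign → ℤ
  | none => 0
  | some ε => signVal ε

/-- The number of `A`-markers minus the number of `B`-markers in a row of kinks. -/
def arcSigma : ∀ m, ArcWord m → ℤ
  | 0, _ => 0
  | m + 1, (l, t) => letterSigma l + arcSigma m t

/-- The number of positive circles minus the number of negative circles of a row of kinks. -/
def arcTau : ∀ m, ArcWord m → ℤ
  | 0, ε => signVal ε
  | m + 1, (l, t) => letterTau l + arcTau m t

/-- The number `σ` for the generators of the complex of `T(2, n)`. -/
def torusSigma : ∀ n, TorusWord n → ℤ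
  | 0, _ => 0
  | n + 1, Sum.inl c => 1 + torusSigma n c
  | n + 1, Sum.inr t => -1 + arcSigma n t

/-- The number `τ` for the generators of the complex of `T(2, n)`. -/
def torusTau : ∀ n, TorusWord n → ℤ
  | 0, (ε, ε') => signVal ε + signVal ε'
  | n + 1, Sum.inl c => torusTau n c
  | n + 1, Sum.inr t => arcTau n t

/-- The bidegree of a generator of the complex of a row of kinks. -/
def arcDegree (m : ℕ) (t : ArcWord m) : ℤ × ℤ :=
  (arcSigma m t, arcSigma m t + 2 * arcTau m t)

/-- The bidegree of a generator of the complex of `T(2, n)`. -/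
def torusDegree (n : ℕ) (c : TorusWord n) : ℤ × ℤ :=
  (torusSigma n c, torusSigma n c + 2 * torusTau n c)

/-- The bidegree of a generator of the complex of a circle without crossings. -/
def signDegree (ε : CircleSign) : ℤ × ℤ :=
  (0, 2 * signVal ε)

/-- The bidegree of a generator of the reduced complex of `T(2, n)`. -/
def reducedDegree (n : ℕ) : ReducedWord n → ℤ × ℤ
  | Sum.inl (ε, ε') => (n, n + 2 * (signVal ε + signVal ε'))
  | Sum.inr (k, ε) => (n - 2 * k - 2, n - 4 * k - 2 + 2 * signVal ε)

theorem arcDegree_succ (m : ℕ) (l : Option CircleSign) (t : ArcWord m) :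
    arcDegree (m + 1) (l, t) =
      arcDegree m t + (letterSigma l, letterSigma l + 2 * letterTau l) := by
  simp only [arcDegree, arcSigma, arcTau, Prod.mk_add_mk, Prod.mk.injEq]
  constructor <;> ring

theorem torusDegree_inl (n : ℕ) (c : TorusWord n) :
    torusDegree (n + 1) (Sum.inl c) = torusDegree n c + (1, 1) := by
  simp only [torusDegree, torusSigma, torusTau, Prod.mk_add_mk, Prod.mk.injEq]
  constructor <;> ring

theorem torusDegree_inr (n : ℕ) (t : ArcWord n) :
    torusDegree (n + 1) (Sum.inr t) = arcDegree n t + (-1, -1) := by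
  simp only [torusDegree, arcDegree, torusSigma, torusTau, Prod.mk_add_mk, Prod.mk.injEq]
  constructor <;> ring

theorem reducedDegree_inl (n : ℕ) (p : CircleSign × CircleSign) :
    reducedDegree (n + 1) (Sum.inl p) = reducedDegree n (Sum.inl p) + (1, 1) := by
  simp only [reducedDegree, Prod.mk_add_mk, Prod.mk.injEq, Nat.cast_add, Nat.cast_one, true_and]
  ring

theorem reducedDegree_castSucc (n : ℕ) (k : Fin n) (ε : CircleSign) :
    reducedDegree (n + 1) (Sum.inr (k.castSucc, ε)) =
      reducedDegree n (Sum.inr (k, ε)) + (1, 1) := by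
  simp only [reducedDegree, Prod.mk_add_mk, Prod.mk.injEq, Nat.cast_add, Nat.cast_one,
    Fin.val_castSucc]
  constructor <;> ring

theorem reducedDegree_last (n : ℕ) (ε : CircleSign) :
    reducedDegree (n + 1) (Sum.inr (Fin.last n, ε)) + ((n : ℤ), 3 * (n : ℤ)) =
      signDegree ε + (-1, -1) := by
  simp only [reducedDegree, signDegree, Prod.mk_add_mk, Prod.mk.injEq, Nat.cast_add, Nat.cast_one,
    Fin.val_last]
  constructor <;> ring

theorem raisesDegree_lastX : ∀ m, RaisesDegree (arcDegree m) (arcDegree m) (0, 4) (lastX m)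
  | 0, _, plus, hz => hz minus rfl
  | 0, _, minus, _ => rfl
  | m + 1, _, (none, t), hz =>
    raisesDegree_lastX m _ t fun t' ht => hz (none, t') (by
      rw [arcDegree_succ, arcDegree_succ, ← ht, add_right_comm])
  | _ + 1, _, (some plus, t), hz => hz (some minus, t) (by
      rw [arcDegree_succ, arcDegree_succ, add_assoc]; rfl)
  | _ + 1, _, (some minus, _), _ => rfl

theorem raisesDegree_kinkRetract (m : ℕ) :
    RaisesDegree (arcDegree (m + 1)) (arcDegree m) (1, 3)
      (kinkRetract (lastX m) ∘ₗ (arcCurry m).toLinearMap) := by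
  intro z t hz
  refine sub_eq_zero.2 ((hz (some minus, t) ?_).trans
    (raisesDegree_lastX m _ t fun t' ht => ?_).symm)
  · rw [arcDegree_succ, add_assoc]
    exact add_zero _
  · refine hz (some plus, t') ?_
    rw [arcDegree_succ, ← ht, add_assoc]
    rfl

theorem raisesDegree_arcAug : ∀ m : ℕ,
    RaisesDegree (arcDegree m) signDegree ((m : ℤ), 3 * (m : ℤ)) (arcAug m)
  | 0, _, ε, hz => hz ε (by
      simp [arcDegree, signDegree, arcSigma, arcTau])
  | m + 1, z, ε, hz => by
    refine (raisesDegree_arcAug m).comp (raisesDegree_kinkRetract m) z ε fun t ht => hz t ?_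
    rw [← ht]
    congr 1
    simp only [Prod.mk_add_mk, Prod.mk.injEq, Nat.cast_add, Nat.cast_one]
    constructor <;> ring

theorem raisesDegree_torusAug : ∀ n, RaisesDegree (torusDegree n) (reducedDegree n) 0 (torusAug n)
  | 0, _, Sum.inl p, hz => hz p (by
      simp [torusDegree, reducedDegree, torusSigma, torusTau])
  | 0, _, Sum.inr (k, _), _ => k.elim0
  | n + 1, z, Sum.inl p, hz => by
    refine raisesDegree_torusAug n (torusSplit n z).1 (Sum.inl p) fun c hc => hz (Sum.inl c) ?_
    rw [torusDegree_inl, reducedDegree_inl, ← hc, add_right_comm]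
  | n + 1, z, Sum.inr (k, ε), hz => by
    change reducedJoin n ((torusAug n).prodMap (arcAug n) (torusSplit n z)) (Sum.inr (k, ε)) = 0
    induction k using Fin.lastCases with
    | cast k =>
      rw [reducedJoin_castSucc]
      refine raisesDegree_torusAug n _ (Sum.inr (k, ε)) fun c hc => hz (Sum.inl c) ?_
      rw [torusDegree_inl, reducedDegree_castSucc, ← hc, add_right_comm]
    | last =>
      rw [reducedJoin_last]
      refine raisesDegree_arcAug n _ ε fun t ht => hz (Sum.inr t) (add_right_cancel
        (b := ((n : ℤ), 3 * (n : ℤ))) ?_)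
      rw [torusDegree_inr, add_zero, reducedDegree_last, ← ht, add_right_comm]

section ReducedHomology

variable {n : ℕ}

theorem eq_of_reducedDegree_eq {i j : ReducedWord n} (hi : reducedDegree n i ≠ ((n : ℤ), (n : ℤ)))
    (hij : reducedDegree n j = reducedDegree n i) : j = i := by
  rcases i with ⟨_ | _, _ | _⟩ | ⟨⟨k, hk⟩, _ | _⟩ <;>
    rcases j with ⟨_ | _, _ | _⟩ | ⟨⟨l, hl⟩, _ | _⟩ <;>
    simp [reducedDegree, signVal] at hij hi ⊢ <;> omega

theorem reducedDegree_inr_ne (k : Fin n) (ε : CircleSign) :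
    reducedDegree n (Sum.inr (k, ε)) ≠ ((n : ℤ), (n : ℤ)) := fun h => by
  have hσ : (n - 2 * k - 2 : ℤ) = n := congrArg Prod.fst h
  omega

theorem reducedDiff_single_plus (k : Fin n) (r : ℤ) :
    reducedDiff n (Pi.single (Sum.inr (k, plus)) r) = 0 := by
  ext (_ | ⟨⟨_ | j, _⟩, _ | _⟩) <;> simp [reducedDiff, signMul, signX]

theorem reducedDiff_single_minus {k : ℕ} (hk : k + 1 < n) (r : ℤ) :
    reducedDiff n (Pi.single (Sum.inr (⟨k, Nat.lt_of_succ_lt hk⟩, minus)) r) =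
      Pi.single (Sum.inr (⟨k + 1, hk⟩, plus)) ((1 - (-1) ^ k) * r) := by
  ext (_ | ⟨⟨_ | j, hj⟩, _ | _⟩)
  case inr.succ.plus =>
    by_cases hjk : j = k
    · subst hjk
      simp [reducedDiff, signX]
    · simp [reducedDiff, signX, hjk]
  all_goals simp [reducedDiff, signMul, signX]

theorem reducedDiff_single_last_minus {k : Fin n} (hk : k + 1 = n) (r : ℤ) :
    reducedDiff n (Pi.single (Sum.inr (k, minus)) r) = 0 := by
  ext (_ | ⟨⟨_ | j, hj⟩, _ | _⟩)
  case inr.succ.plus =>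
    have hjk : ⟨j, Nat.lt_of_succ_lt hj⟩ ≠ k := by
      rintro rfl
      exact hj.ne hk
    simp [reducedDiff, signX, hjk]
  all_goals simp [reducedDiff, signMul, signX]

theorem one_sub_neg_one_pow_of_even {k : ℕ} (hk : Even k) : (1 - (-1) ^ k : ℤ) = 0 :=
  sub_eq_zero.2 hk.neg_one_pow.symm

theorem one_sub_neg_one_pow_of_odd {k : ℕ} (hk : Odd k) : (1 - (-1) ^ k : ℤ) = 2 := by
  rw [hk.neg_one_pow]
  rfl

theorem hasHomology_reducedDiff_top (hn : 0 < n) :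
    HasHomology (reducedDiff n) (reducedDegree n) ((n : ℤ), (n : ℤ)) ℤ := by
  refine ⟨LinearMap.proj (Sum.inl (plus, minus)), fun r => ?_, fun x hx hex => ?_⟩
  · refine ⟨Pi.single (Sum.inl (plus, minus)) r - Pi.single (Sum.inl (minus, plus)) r, ?_, ?_, ?_⟩
    · rintro (⟨_ | _, _ | _⟩ | ⟨k, ε⟩) hi <;> simp [reducedDegree, signVal] at hi ⊢
    · ext (_ | ⟨⟨_ | j, _⟩, _ | _⟩) <;> simp [reducedDiff, signMul, signX]
    · simp
  have hsum : x (Sum.inl (plus, minus)) + x (Sum.inl (minus, plus)) = 0 :=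
    congrFun hex (Sum.inr (⟨0, hn⟩, plus))
  constructor
  · intro hpm
    replace hpm : x (Sum.inl (plus, minus)) = 0 := hpm
    have hmp : x (Sum.inl (minus, plus)) = 0 := by rwa [hpm, zero_add] at hsum
    refine ⟨0, (map_zero _).trans (funext ?_)⟩
    rintro (⟨_ | _, _ | _⟩ | ⟨k, ε⟩)
    · exact (hx _ (by simp [reducedDegree, signVal])).symm
    · exact hpm.symm
    · exact hmp.symm
    · exact (hx _ (by simp [reducedDegree, signVal])).symm
    · exact (hx _ (reducedDegree_inr_ne k ε)).symm
  · rintro ⟨y, rfl⟩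
    rfl

theorem HasHomology.reduced_int {i : ReducedWord n}
    (hi : reducedDegree n i ≠ ((n : ℤ), (n : ℤ))) (he : ∀ r, reducedDiff n (Pi.single i r) = 0)
    (hb : ∀ y, reducedDiff n y i = 0) :
    HasHomology (reducedDiff n) (reducedDegree n) (reducedDegree n i) ℤ := by
  refine .of_unique (fun j => eq_of_reducedDegree_eq hi) he LinearMap.id Function.surjective_id ?_
  refine fun r => ⟨?_, ?_⟩
  · rintro rfl
    exact ⟨0, by rw [map_zero, Pi.single_zero]⟩
  · rintro ⟨y, hy⟩
    have hr := hb y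
    rwa [hy, Pi.single_eq_same] at hr

theorem hasHomology_reducedDiff_plus_plus :
    HasHomology (reducedDiff n) (reducedDegree n) (reducedDegree n (Sum.inl (plus, plus))) ℤ := by
  refine .reduced_int (by simp [reducedDegree, signVal]) (fun r => ?_) fun y => rfl
  ext (_ | ⟨⟨_ | j, _⟩, _ | _⟩) <;> simp [reducedDiff, signMul, signX]

theorem hasHomology_reducedDiff_minus_minus (hn : 0 < n) :
    HasHomology (reducedDiff n) (reducedDegree n) (reducedDegree n (Sum.inl (minus, minus)))
      PUnit := by
  refine .of_forall_boundary fun x hx hex => ⟨0, (map_zero _).trans ?_⟩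
  have hxm : x (Sum.inl (minus, minus)) = 0 := congrFun hex (Sum.inr (⟨0, hn⟩, minus))
  rw [hx.eq_single fun _ => eq_of_reducedDegree_eq (by simp [reducedDegree, signVal]), hxm,
    Pi.single_zero]

theorem hasHomology_reducedDiff_zero (hn : 0 < n) (ε : CircleSign) :
    HasHomology (reducedDiff n) (reducedDegree n) (reducedDegree n (Sum.inr (⟨0, hn⟩, ε)))
      PUnit := by
  refine .of_forall_boundary fun x hx _ => ?_
  rw [hx.eq_single fun _ => eq_of_reducedDegree_eq (reducedDegree_inr_ne _ ε)]
  refine ⟨Pi.single (Sum.inl (ε, minus)) (x (Sum.inr (⟨0, hn⟩, ε))), ?_⟩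
  rcases ε with _ | _ <;> ext (_ | ⟨⟨_ | j, _⟩, _ | _⟩) <;> simp [reducedDiff, signMul, signX]

theorem hasHomology_reducedDiff_succ_plus_of_even {k : ℕ} (hk : Even k) (hkn : k + 1 < n) :
    HasHomology (reducedDiff n) (reducedDegree n) (reducedDegree n (Sum.inr (⟨k + 1, hkn⟩, plus)))
      ℤ :=
  .reduced_int (reducedDegree_inr_ne _ plus) (reducedDiff_single_plus _) fun _ =>
    mul_eq_zero_of_left (one_sub_neg_one_pow_of_even hk) _

theorem hasHomology_reducedDiff_succ_plus_of_odd {k : ℕ} (hk : Odd k) (hkn : k + 1 < n) :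
    HasHomology (reducedDiff n) (reducedDegree n) (reducedDegree n (Sum.inr (⟨k + 1, hkn⟩, plus)))
      (ZMod 2) := by
  refine .of_unique (fun _ => eq_of_reducedDegree_eq (reducedDegree_inr_ne _ plus))
    (reducedDiff_single_plus _) (Int.castAddHom (ZMod 2)).toIntLinearMap ZMod.intCast_surjective
    fun r => ?_
  refine Iff.trans (ZMod.intCast_zmod_eq_zero_iff_dvd r 2) ⟨?_, ?_⟩
  · rintro ⟨s, rfl⟩
    exact ⟨_, (reducedDiff_single_minus hkn s).trans (by rw [one_sub_neg_one_pow_of_odd hk]; rfl)⟩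
  · rintro ⟨y, hy⟩
    refine ⟨y (Sum.inr (⟨k, Nat.lt_of_succ_lt hkn⟩, minus)), ?_⟩
    have hr := congrFun hy (Sum.inr (⟨k + 1, hkn⟩, plus))
    rw [Pi.single_eq_same] at hr
    rw [← hr]
    exact congrArg (· * _) (one_sub_neg_one_pow_of_odd hk)

theorem hasHomology_reducedDiff_succ_minus {k : ℕ} (hkn : k + 1 < n) (h : Odd k ∨ k + 2 = n) :
    HasHomology (reducedDiff n) (reducedDegree n)
      (reducedDegree n (Sum.inr (⟨k + 1, hkn⟩, minus))) ℤ := by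
  refine .reduced_int (reducedDegree_inr_ne _ minus) (fun r => ?_) fun _ => mul_zero _
  by_cases hne : k + 2 = n
  · exact reducedDiff_single_last_minus hne r
  · rw [reducedDiff_single_minus (lt_of_le_of_ne hkn hne),
      one_sub_neg_one_pow_of_even (h.resolve_right hne).add_one, zero_mul, Pi.single_zero]

theorem hasHomology_reducedDiff_minus_of_odd {k : ℕ} (hk : Odd k) (hkn : k + 1 < n) :
    HasHomology (reducedDiff n) (reducedDegree n)
      (reducedDegree n (Sum.inr (⟨k, Nat.lt_of_succ_lt hkn⟩, minus))) PUnit := by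
  refine .of_forall_boundary fun x hx hex => ⟨0, (map_zero _).trans ?_⟩
  have hxk : (1 - (-1) ^ k) * x (Sum.inr (⟨k, Nat.lt_of_succ_lt hkn⟩, minus)) = 0 :=
    congrFun hex (Sum.inr (⟨k + 1, hkn⟩, plus))
  rw [one_sub_neg_one_pow_of_odd hk, mul_eq_zero_iff_left two_ne_zero] at hxk
  rw [hx.eq_single fun _ => eq_of_reducedDegree_eq (reducedDegree_inr_ne _ minus), hxk,
    Pi.single_zero]

theorem hasHomology_reducedDiff_of_forall_ne {p : ℤ × ℤ} (h : ∀ i, reducedDegree n i ≠ p) :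
    HasHomology (reducedDiff n) (reducedDegree n) p PUnit :=
  .of_forall_boundary fun _ hx _ => ⟨0, (map_zero _).trans (funext fun i => (hx i (h i)).symm)⟩

theorem reducedDegree_succ_plus {k : ℕ} (hk : k + 1 < n) :
    reducedDegree n (Sum.inr (⟨k + 1, hk⟩, plus)) =
      (n - 2 * ((k + 2 : ℕ) : ℤ), n - 4 * ((k + 2 : ℕ) : ℤ) + 4) := by
  simp only [reducedDegree, signVal, Prod.mk.injEq]
  omega

theorem reducedDegree_succ_minus {k : ℕ} (hk : k + 1 < n) :
    reducedDegree n (Sum.inr (⟨k + 1, hk⟩, minus)) =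
      (n - 2 * ((k + 2 : ℕ) : ℤ), n - 4 * ((k + 2 : ℕ) : ℤ)) := by
  simp only [reducedDegree, signVal, Prod.mk.injEq]
  omega

theorem hasHomology_reducedDiff_int (hn : 0 < n) {a b : ℤ}
    (h : (a = n ∧ b = n) ∨ (2 ≤ n ∧ a = -n ∧ b = -3 * n) ∨
      (∃ s : ℕ, Even s ∧ s ≤ n ∧ a = n - 2 * s ∧ b = n - 4 * s + 4) ∨
      ∃ s : ℕ, Odd s ∧ 3 ≤ s ∧ s ≤ n ∧ a = n - 2 * s ∧ b = n - 4 * s) :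
    HasHomology (reducedDiff n) (reducedDegree n) (a, b) ℤ := by
  rcases h with ⟨rfl, rfl⟩ | ⟨h2, rfl, rfl⟩ | ⟨s, hs, hsn, rfl, rfl⟩ | ⟨s, hs, h3, hsn, rfl, rfl⟩
  · exact hasHomology_reducedDiff_top hn
  · obtain ⟨k, rfl⟩ := Nat.exists_eq_add_of_le' h2
    convert hasHomology_reducedDiff_succ_minus (k + 1).lt_succ_self (.inr rfl) using 1
    rw [reducedDegree_succ_minus, Prod.mk.injEq]
    omega
  · obtain _ | _ | k := s
    · convert hasHomology_reducedDiff_plus_plus using 1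
      simp only [reducedDegree, signVal, Prod.mk.injEq]
      omega
    · cases Nat.not_even_one hs
    · rw [← reducedDegree_succ_plus hsn]
      exact hasHomology_reducedDiff_succ_plus_of_even (by simpa [Nat.even_add] using hs) hsn
  · obtain ⟨k, rfl⟩ := Nat.exists_eq_add_of_le' (Nat.le_of_succ_le h3)
    rw [← reducedDegree_succ_minus hsn]
    exact hasHomology_reducedDiff_succ_minus hsn (.inl (by simpa [Nat.odd_add] using hs))

theorem hasHomology_reducedDiff_zmod_two {a b : ℤ}
    (h : ∃ s : ℕ, Odd s ∧ 3 ≤ s ∧ s ≤ n ∧ a = n - 2 * s ∧ b = n - 4 * s + 4) :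
    HasHomology (reducedDiff n) (reducedDegree n) (a, b) (ZMod 2) := by
  obtain ⟨s, hs, h3, hsn, rfl, rfl⟩ := h
  obtain ⟨k, rfl⟩ := Nat.exists_eq_add_of_le' (Nat.le_of_succ_le h3)
  rw [← reducedDegree_succ_plus hsn]
  exact hasHomology_reducedDiff_succ_plus_of_odd (by simpa [Nat.odd_add] using hs) hsn

theorem hasHomology_reducedDiff_punit (hn : 0 < n) {a b : ℤ}
    (hint : ¬((a = n ∧ b = n) ∨ (2 ≤ n ∧ a = -n ∧ b = -3 * n) ∨
      (∃ s : ℕ, Even s ∧ s ≤ n ∧ a = n - 2 * s ∧ b = n - 4 * s + 4) ∨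
      ∃ s : ℕ, Odd s ∧ 3 ≤ s ∧ s ≤ n ∧ a = n - 2 * s ∧ b = n - 4 * s))
    (hzmod : ¬∃ s : ℕ, Odd s ∧ 3 ≤ s ∧ s ≤ n ∧ a = n - 2 * s ∧ b = n - 4 * s + 4) :
    HasHomology (reducedDiff n) (reducedDegree n) (a, b) PUnit := by
  simp only [not_or] at hint
  obtain ⟨htop, hbot, heven, hodd⟩ := hint
  by_cases hi : ∃ i, reducedDegree n i = (a, b)
  swap
  · exact hasHomology_reducedDiff_of_forall_ne (not_exists.1 hi)
  obtain ⟨⟨_ | _, _ | _⟩ | ⟨⟨_ | k, hk⟩, _ | _⟩, hi⟩ := hi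
  · obtain ⟨rfl, rfl⟩ := Prod.mk.inj hi
    exact absurd ⟨0, Even.zero, n.zero_le, by simp, by simp [signVal]⟩ heven
  · exact absurd (by simpa [reducedDegree, signVal, eq_comm] using hi) htop
  · exact absurd (by simpa [reducedDegree, signVal, eq_comm] using hi) htop
  · exact hi ▸ hasHomology_reducedDiff_minus_minus hn
  · exact hi ▸ hasHomology_reducedDiff_zero hn plus
  · exact hi ▸ hasHomology_reducedDiff_zero hn minus
  · obtain ⟨rfl, rfl⟩ := Prod.mk.inj ((reducedDegree_succ_plus hk).symm.trans hi)
    rcases Nat.even_or_odd (k + 2) with hs | hs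
    · exact absurd ⟨k + 2, hs, hk, rfl, rfl⟩ heven
    · exact absurd ⟨k + 2, hs, by grind, hk, rfl, rfl⟩ hzmod
  · obtain ⟨ha, hb⟩ := Prod.mk.inj ((reducedDegree_succ_minus hk).symm.trans hi)
    rcases Nat.even_or_odd (k + 1) with hs | hs
    · exact absurd ⟨k + 2, hs.add_one, by grind, hk, ha.symm, hb.symm⟩ hodd
    · have hkn : k + 2 ≠ n := fun h => hbot (by omega)
      exact hi ▸ hasHomology_reducedDiff_minus_of_odd hs (lt_of_le_of_ne hk hkn)

end ReducedHomology

section Letters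

open Function

/-- The letters of a row of kinks, as a function that is `none` off the kinks. -/
def arcLetter : ∀ m, ArcWord m → ℕ → Option CircleSign
  | 0, _ => fun _ => none
  | m + 1, (l, t) => update (arcLetter m t) m l

/-- The sign of the base circle of a row of kinks. -/
def arcBase : ∀ m, ArcWord m → CircleSign
  | 0, ε => ε
  | m + 1, (_, t) => arcBase m t

/-- The letter at the crossing `i` of `T(2, n)`: `none` for an `A`-marker, and the sign of the
circle above the crossing for a `B`-marker. -/
def torusLetter : ∀ n, TorusWord n → ℕ → Option CircleSign
  | 0, _ => fun _ => none
  | n + 1, Sum.inl c => torusLetter n c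
  | n + 1, Sum.inr t => update (arcLetter n t) n (some (arcBase n t))

/-- The signs of the left (`false`) and the right (`true`) circle, if all markers are `A`. -/
def torusSide : ∀ n, TorusWord n → Bool → Option CircleSign
  | 0, p => fun b => some (bif b then p.2 else p.1)
  | n + 1, Sum.inl c => torusSide n c
  | _ + 1, Sum.inr _ => fun _ => none

/-- The last place before `j` that carries a sign. -/
def lastMark (w : ℕ → Option CircleSign) : ℕ → Option ℕ
  | 0 => none
  | j + 1 => if (w j).isSome then some j else lastMark w j

/-- The last place cyclically before `j`, among `n` places, that carries a sign. -/
def cyclicMark (n : ℕ) (w : ℕ → Option CircleSign) (j : ℕ) : Option ℕ :=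
  (lastMark w j).or (lastMark w n)

/-- The number of places after `v`, among `n` places, that carry a sign. -/
def marksAfter (n : ℕ) (w : ℕ → Option CircleSign) (v : ℕ) : ℕ :=
  ((Finset.range n).filter fun u => v < u ∧ (w u).isSome).card

/-- Words that agree up to the sign at the place `p`. -/
def AgreeOff (p : Option ℕ) (w w' : ℕ → Option CircleSign) : Prop :=
  ∀ u, (w u).isSome = (w' u).isSome ∧ (p ≠ some u → w u = w' u)

/-- Rows of kinks that agree up to the sign of the circle at `p`, where `none` stands for the base
circle. -/
def ArcAgree (m : ℕ) (p : Option ℕ) (t t' : ArcWord m) : Prop :=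
  AgreeOff p (arcLetter m t) (arcLetter m t') ∧ (p ≠ none → arcBase m t = arcBase m t')

/-- Incidence of rows of kinks at `v`. -/
def ArcIncident (m v : ℕ) (t t' : ArcWord m) : Prop :=
  arcLetter m t v = none ∧ (arcLetter m t' v).isSome ∧ arcTau m t' = arcTau m t + 1 ∧
    AgreeOff (lastMark (arcLetter m t) v) (arcLetter m t) (update (arcLetter m t') v none) ∧
    (lastMark (arcLetter m t) v ≠ none → arcBase m t = arcBase m t')

/-- Incidence of generators of the complex of `T(2, n)` at `v`. -/
def TorusIncident (n v : ℕ) (c c' : TorusWord n) : Prop :=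
  torusLetter n c v = none ∧ (torusLetter n c' v).isSome ∧ torusTau n c' = torusTau n c + 1 ∧
    AgreeOff (cyclicMark n (torusLetter n c) v) (torusLetter n c)
      (update (torusLetter n c') v none)

open Classical in
/-- The Iverson bracket. -/
noncomputable def iverson (P : Prop) : ℤ :=
  if P then 1 else 0

/-- The basis vector of an element of the index type. -/
noncomputable def delta {ι : Type*} (i : ι) : ι → ℤ :=
  fun j => iverson (i = j)

variable {m n v : ℕ} {p : Option ℕ} {w w' : ℕ → Option CircleSign}

theorem lastMark_congr : ∀ {j}, (∀ i < j, (w i).isSome = (w' i).isSome) →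
    lastMark w j = lastMark w' j
  | 0, _ => rfl
  | j + 1, h => by
    rw [lastMark, lastMark, h j j.lt_succ_self,
      lastMark_congr fun i hi => h i (hi.trans j.lt_succ_self)]

theorem lastMark_update_of_le (l : Option CircleSign) (h : v ≤ m) :
    lastMark (update w m l) v = lastMark w v :=
  lastMark_congr fun _ hi => by rw [update_of_ne (hi.trans_le h).ne]

theorem lastMark_succ_of_none (h : w v = none) : lastMark w (v + 1) = lastMark w v := by
  rw [lastMark, h]
  rfl

theorem lastMark_succ_of_isSome (h : (w v).isSome) : lastMark w (v + 1) = some v :=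
  if_pos h

theorem lt_of_lastMark : ∀ {j u}, lastMark w j = some u → u < j
  | j + 1, u, h => by
    rw [lastMark] at h
    split_ifs at h
    · obtain rfl := Option.some.inj h
      exact Nat.lt_succ_self _
    · exact (lt_of_lastMark h).trans j.lt_succ_self

theorem lastMark_ne_some (h : v ≤ m) : lastMark w v ≠ some m :=
  fun h' => (lt_of_lastMark h').not_ge h

theorem agreeOff_none_iff : AgreeOff none w w' ↔ w = w' :=
  ⟨fun h => funext fun u => (h u).2 (Option.some_ne_none u).symm,
    by rintro rfl u; exact ⟨rfl, fun _ => rfl⟩⟩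

theorem agreeOff_some_iff {u : ℕ} (h : w u = w' u) : AgreeOff (some u) w w' ↔ w = w' := by
  refine ⟨fun hw => funext fun i => ?_, by rintro rfl u; exact ⟨rfl, fun _ => rfl⟩⟩
  rcases eq_or_ne i u with rfl | hi
  · exact h
  · exact (hw i).2 fun h' => hi (Option.some.inj h').symm

theorem agreeOff_update (h : w n = none) (h' : w' n = none) (l l' : Option CircleSign) :
    AgreeOff p (update w n l) (update w' n l') ↔
      (l.isSome = l'.isSome ∧ (p ≠ some n → l = l')) ∧ AgreeOff p w w' := by
  simp only [AgreeOff]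
  rw [forall_update_iff w fun u x =>
    x.isSome = (update w' n l' u).isSome ∧ (p ≠ some u → x = update w' n l' u)]
  refine and_congr (by rw [update_self]) (forall_congr' fun u => ?_)
  rcases eq_or_ne u n with rfl | hu
  · simp [h, h']
  · simp [hu]

theorem agreeOff_update_right (h : w n = none) (h' : w' n = none) (l' : Option CircleSign) :
    AgreeOff p w (update w' n l') ↔ l' = none ∧ AgreeOff p w w' := by
  have hw : update w n none = w := by rw [← h, update_eq_self]
  rw [← hw, agreeOff_update h h', hw]
  rcases l' with _ | _ <;> simp

theorem arcLetter_of_le : ∀ {m} (t : ArcWord m) {i}, m ≤ i → arcLetter m t i = none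
  | 0, _, _, _ => rfl
  | m + 1, (l, t), i, h => by
    rw [arcLetter, update_of_ne (by omega)]
    exact arcLetter_of_le t (by omega)

theorem torusLetter_of_le : ∀ {n} (c : TorusWord n) {i}, n ≤ i → torusLetter n c i = none
  | 0, _, _, _ => rfl
  | n + 1, Sum.inl c, i, h => torusLetter_of_le c (by omega)
  | n + 1, Sum.inr t, i, h => by
    rw [torusLetter, update_of_ne (by omega)]
    exact arcLetter_of_le t (by omega)

theorem signVal_injective : Injective signVal := by
  rintro (_ | _) (_ | _) <;> simp [signVal]

theorem letterTau_eq_iff {l l' : Option CircleSign} (h : l.isSome = l'.isSome) :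
    letterTau l = letterTau l' ↔ l = l' := by
  rcases l with _ | ε <;> rcases l' with _ | ε'
  · simp
  · simp at h
  · simp at h
  · exact signVal_injective.eq_iff.trans (Option.some_inj).symm

theorem arcAgree_succ (l l' : Option CircleSign) (t t' : ArcWord m) :
    ArcAgree (m + 1) p (l, t) (l', t') ↔
      (l.isSome = l'.isSome ∧ (p ≠ some m → l = l')) ∧ ArcAgree m p t t' := by
  simp only [ArcAgree, arcLetter, arcBase]
  rw [agreeOff_update (arcLetter_of_le t le_rfl) (arcLetter_of_le t' le_rfl), and_assoc]

theorem ArcAgree.refl (m : ℕ) (p : Option ℕ) (t : ArcWord m) : ArcAgree m p t t :=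
  ⟨fun _ => ⟨rfl, fun _ => rfl⟩, fun _ => rfl⟩

theorem arcAgree_some_iff : ∀ {m u} (_ : m ≤ u) {t t' : ArcWord m},
    ArcAgree m (some u) t t' ↔ t = t'
  | 0, u, _, ε, ε' => ⟨fun h => h.2 (Option.some_ne_none u), fun h => h ▸ .refl 0 (some u) ε⟩
  | m + 1, u, h, (l, t), (l', t') => by
    have hu : some u ≠ some m := fun hu => by cases hu; omega
    refine ⟨fun ht => ?_, fun ht => ht ▸ .refl (m + 1) (some u) (l, t)⟩
    rw [arcAgree_succ, arcAgree_some_iff (Nat.le_of_succ_le h)] at ht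
    exact Prod.ext (ht.1.2 hu) ht.2

theorem arcAgree_and_arcTau_eq_iff : ∀ {m} {p : Option ℕ} {t t' : ArcWord m},
    ArcAgree m p t t' ∧ arcTau m t' = arcTau m t ↔ t = t'
  | 0, p, ε, ε' => ⟨fun h => (signVal_injective h.2).symm, fun h => h ▸ ⟨.refl 0 p ε, rfl⟩⟩
  | m + 1, p, (l, t), (l', t') => by
    refine ⟨fun ⟨h, hτ⟩ => ?_, fun h => h ▸ ⟨.refl (m + 1) p (l, t), rfl⟩⟩
    rw [arcAgree_succ] at h
    obtain ⟨⟨hs, hl⟩, ht⟩ := h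
    rw [arcTau, arcTau] at hτ
    by_cases hp : p = some m
    · obtain rfl := (arcAgree_some_iff le_rfl).1 (hp ▸ ht)
      exact Prod.ext ((letterTau_eq_iff hs).1 (add_right_cancel hτ).symm) rfl
    · obtain rfl := hl hp
      exact Prod.ext rfl (arcAgree_and_arcTau_eq_iff.1 ⟨ht, add_left_cancel hτ⟩)

theorem iverson_of_true {P : Prop} (h : P) : iverson P = 1 :=
  if_pos h

theorem iverson_of_not {P : Prop} (h : ¬P) : iverson P = 0 :=
  if_neg h

theorem arcCurry_delta_self (l : Option CircleSign) (t : ArcWord m) :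
    arcCurry m (delta (l, t)) l = delta t :=
  funext fun _ => congrArg iverson (propext ⟨congrArg Prod.snd, congrArg (Prod.mk l)⟩)

theorem arcCurry_delta_of_ne {l l' : Option CircleSign} (h : l ≠ l') (t : ArcWord m) :
    arcCurry m (delta (l, t)) l' = 0 :=
  funext fun _ => iverson_of_not fun h' => h (congrArg Prod.fst h')

theorem torusSplit_delta_inl (c : TorusWord n) :
    torusSplit n (delta (Sum.inl c)) = (delta c, 0) :=
  Prod.ext (funext fun _ => congrArg iverson (Sum.inl.injEq ..))
    (funext fun _ => iverson_of_not Sum.inl_ne_inr)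

theorem torusSplit_delta_inr (t : ArcWord n) :
    torusSplit n (delta (Sum.inr t)) = (0, delta t) :=
  Prod.ext (funext fun _ => iverson_of_not Sum.inr_ne_inl)
    (funext fun _ => congrArg iverson (Sum.inr.injEq ..))

theorem signX_delta_apply (ε ε' : CircleSign) :
    signX (delta ε) ε' = iverson (signVal ε' = signVal ε + 2) := by
  rcases ε with _ | _ <;> rcases ε' with _ | _ <;> simp [signX, delta, iverson, signVal]

theorem kinkX_delta_some (l : Option CircleSign) (ε : CircleSign) (t t' : ArcWord m) :
    kinkX (lastX m) (arcCurry m (delta (l, t))) (some ε) t' =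
      iverson (l.isSome ∧ letterTau (some ε) = letterTau l + 2 ∧ t = t') := by
  have hminus : kinkX (lastX m) (arcCurry m (delta (l, t))) (some minus) t' = 0 := rfl
  have hplus : kinkX (lastX m) (arcCurry m (delta (l, t))) (some plus) t' =
      arcCurry m (delta (l, t)) (some minus) t' := rfl
  rcases ε with _ | _
  · rcases l with _ | _ | _
    · rw [hplus, arcCurry_delta_of_ne (by simp), iverson_of_not (by simp), Pi.zero_apply]
    · rw [hplus, arcCurry_delta_of_ne (by simp), iverson_of_not (by simp [letterTau, signVal]),
        Pi.zero_apply]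
    · rw [hplus, arcCurry_delta_self]
      simp [letterTau, signVal, delta]
  · rw [hminus, iverson_of_not]
    rcases l with _ | _ | _ <;> simp [letterTau, signVal]

theorem lastX_delta_apply : ∀ {m} (t t' : ArcWord m), lastX m (delta t) t' = iverson
    (ArcAgree m (lastMark (arcLetter m t) m) t t' ∧ arcTau m t' = arcTau m t + 2)
  | 0, ε, ε' => by
    refine (signX_delta_apply ε ε').trans (congrArg iverson (propext (and_iff_right ?_).symm))
    exact ⟨fun _ => ⟨rfl, fun _ => rfl⟩, fun h => absurd rfl h⟩
  | m + 1, (none, t), (none, t') => by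
    change lastX m (arcCurry m _ none) t' = _
    rw [arcCurry_delta_self, lastX_delta_apply, arcAgree_succ, arcLetter, arcTau, arcTau,
      lastMark_succ_of_none (update_self ..), lastMark_update_of_le none le_rfl, add_assoc,
      add_right_inj]
    simp only [true_and, implies_true]
  | m + 1, (some ε, t), (none, t') => by
    change lastX m (arcCurry m _ none) t' = _
    rw [arcCurry_delta_of_ne (Option.some_ne_none ε), map_zero, arcAgree_succ,
      iverson_of_not fun h => Bool.noConfusion h.1.1.1]
    rfl
  | m + 1, (l, t), (some ε', t') => by
    rw [arcAgree_succ]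
    refine (kinkX_delta_some l ε' t t').trans (congrArg iverson (propext ?_))
    rcases l with _ | ε
    · exact iff_of_false (fun h => Bool.noConfusion h.1) fun h => Bool.noConfusion h.1.1.1
    · rw [arcLetter, lastMark_succ_of_isSome (by rw [update_self]; rfl),
        arcAgree_some_iff le_rfl, arcTau, arcTau, letterTau, letterTau]
      grind

theorem baseX_delta_apply : ∀ {m} (t t' : ArcWord m), baseX m (delta t) t' =
    iverson (ArcAgree m none t t' ∧ arcTau m t' = arcTau m t + 2)
  | 0, ε, ε' => by
    refine (signX_delta_apply ε ε').trans (congrArg iverson (propext (and_iff_right ?_).symm))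
    exact ⟨fun _ => ⟨rfl, fun _ => rfl⟩, fun h => absurd rfl h⟩
  | m + 1, (l, t), (l', t') => by
    change baseX m (arcCurry m _ l') t' = _
    rw [arcAgree_succ, arcTau, arcTau]
    rcases eq_or_ne l l' with rfl | hl
    · rw [arcCurry_delta_self, baseX_delta_apply, add_assoc, add_right_inj]
      simp only [true_and, implies_true]
    · rw [arcCurry_delta_of_ne hl, map_zero,
        iverson_of_not fun h => hl (h.1.1.2 (Option.some_ne_none m).symm)]
      rfl

theorem signMul_delta_apply (p : CircleSign × CircleSign) (ε : CircleSign) :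
    signMul (delta p) ε = iverson (signVal ε = signVal p.1 + signVal p.2 + 1) := by
  rcases p with ⟨_ | _, _ | _⟩ <;> rcases ε with _ | _ <;>
    simp [signMul, delta, iverson, signVal]

theorem arcAgree_none_iff {t t' : ArcWord m} :
    ArcAgree m none t t' ↔ AgreeOff (some m) (arcLetter m t) (arcLetter m t') := by
  rw [ArcAgree, agreeOff_none_iff, agreeOff_some_iff]
  · simp only [ne_eq, not_true_eq_false, IsEmpty.forall_iff, and_true]
  · rw [arcLetter_of_le t le_rfl, arcLetter_of_le t' le_rfl]

theorem closeUp_delta_apply : ∀ {n} (c : TorusWord n) (t : ArcWord n),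
    closeUp n (delta c) t = iverson
      (AgreeOff (lastMark (torusLetter n c) n) (torusLetter n c) (arcLetter n t) ∧
        arcTau n t = torusTau n c + 1)
  | 0, c, ε => by
    refine (signMul_delta_apply c ε).trans (congrArg iverson (propext (and_iff_right ?_).symm))
    exact fun _ => ⟨rfl, fun _ => rfl⟩
  | n + 1, Sum.inl c, (l, t) => by
    have hc : torusLetter n c n = none := torusLetter_of_le c le_rfl
    rw [torusLetter, arcLetter, lastMark_succ_of_none hc,
      agreeOff_update_right hc (arcLetter_of_le t le_rfl)]
    rcases l with _ | _ | _
    · change closeUp n (torusSplit n _).1 t = _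
      rw [torusSplit_delta_inl, closeUp_delta_apply, arcTau, torusTau, letterTau, zero_add,
        eq_self, true_and]
    · change (torusSplit n (delta (Sum.inl c))).2 t = _
      rw [torusSplit_delta_inl, iverson_of_not fun h => Option.some_ne_none _ h.1.1]
      rfl
    · change baseX n (torusSplit n _).2 t = _
      rw [torusSplit_delta_inl, map_zero, iverson_of_not fun h => Option.some_ne_none _ h.1.1]
      rfl
  | n + 1, Sum.inr t, (l, t') => by
    rw [torusLetter, arcLetter, lastMark_succ_of_isSome (by rw [update_self]; rfl),
      agreeOff_update (arcLetter_of_le t le_rfl) (arcLetter_of_le t' le_rfl), ← arcAgree_none_iff,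
      arcTau, torusTau]
    rcases l with _ | _ | _
    · change closeUp n (torusSplit n _).1 t' = _
      rw [torusSplit_delta_inr, map_zero, iverson_of_not fun h => Bool.noConfusion h.1.1.1]
      rfl
    · change (torusSplit n (delta (Sum.inr t))).2 t' = _
      rw [torusSplit_delta_inr, letterTau, signVal]
      change iverson (t = t') = _
      rw [← arcAgree_and_arcTau_eq_iff (p := none)]
      refine congrArg iverson (propext ?_)
      grind
    · change baseX n (torusSplit n _).2 t' = _
      rw [torusSplit_delta_inr, baseX_delta_apply, letterTau, signVal]
      refine congrArg iverson (propext ?_)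
      grind

theorem marksAfter_last (w : ℕ → Option CircleSign) : marksAfter (n + 1) w n = 0 := by
  rw [marksAfter, Finset.card_eq_zero, Finset.filter_eq_empty_iff]
  intro u hu h
  have := Finset.mem_range.1 hu
  omega

theorem neg_one_pow_marksAfter_succ (w : ℕ → Option CircleSign) (h : v < n) :
    (-1 : ℤ) ^ marksAfter (n + 1) w v = letterSigma (w n) * (-1) ^ marksAfter n w v := by
  rw [marksAfter, Finset.range_add_one, Finset.filter_insert]
  rcases w n with _ | _
  · rw [if_neg (by simp), letterSigma, one_mul, marksAfter]
  · rw [if_pos (by simp [h]), Finset.card_insert_of_notMem (by simp), pow_succ', letterSigma,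
      marksAfter]

theorem marksAfter_update (w : ℕ → Option CircleSign) (l : Option CircleSign) :
    marksAfter n (update w n l) v = marksAfter n w v := by
  refine congrArg Finset.card (Finset.filter_congr fun u hu => ?_)
  rw [update_of_ne (Finset.mem_range.1 hu).ne]

theorem arcIncident_of_lt (h : v < m) (l l' : Option CircleSign) (t t' : ArcWord m) :
    ArcIncident (m + 1) v (l, t) (l', t') ↔ l = l' ∧ ArcIncident m v t t' := by
  have hm : lastMark (arcLetter m t) v ≠ some m := lastMark_ne_some h.le
  simp only [ArcIncident, arcLetter, arcBase, arcTau]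
  rw [update_of_ne h.ne, update_of_ne h.ne, lastMark_update_of_le l h.le, update_comm h.ne',
    agreeOff_update (arcLetter_of_le t le_rfl)
      (by rw [update_of_ne h.ne', arcLetter_of_le t' le_rfl])]
  constructor
  · rintro ⟨hv, hv', hτ, ⟨⟨-, hl⟩, hagree⟩, hbase⟩
    obtain rfl := hl hm
    exact ⟨rfl, hv, hv', by linarith, hagree, hbase⟩
  · rintro ⟨rfl, hv, hv', hτ, hagree, hbase⟩
    exact ⟨hv, hv', by linarith, ⟨⟨rfl, fun _ => rfl⟩, hagree⟩, hbase⟩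

theorem arcIncident_last (l l' : Option CircleSign) (t t' : ArcWord m) :
    ArcIncident (m + 1) m (l, t) (l', t') ↔
      l = none ∧ l'.isSome ∧ ArcAgree m (lastMark (arcLetter m t) m) t t' ∧
        letterTau l' + arcTau m t' = arcTau m t + 1 := by
  have hw : update (arcLetter m t') m none = arcLetter m t' := by
    rw [← arcLetter_of_le t' le_rfl, update_eq_self]
  simp only [ArcIncident, ArcAgree, arcLetter, arcBase, arcTau, update_self, update_idem, hw,
    lastMark_update_of_le l le_rfl]
  refine and_congr_right fun hl => ?_
  subst hl
  have ht : update (arcLetter m t) m none = arcLetter m t := by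
    rw [← arcLetter_of_le t le_rfl, update_eq_self]
  rw [ht, letterTau, zero_add]
  tauto

theorem kinkDiff_delta_none (l' : Option CircleSign) (t t' : ArcWord m) :
    kinkDiff (arcDiff m) (lastX m) (arcCurry m (delta (none, t))) l' t' =
      iverson (none = l') * arcDiff m (delta t) t' +
        iverson (ArcIncident (m + 1) m (none, t) (l', t')) := by
  rw [arcIncident_last]
  rcases l' with _ | _ | _
  · rw [kinkDiff_none, arcCurry_delta_self, iverson_of_true rfl, one_mul,
      iverson_of_not fun h => Bool.noConfusion h.2.1, add_zero]
  · rw [kinkDiff_plus, arcCurry_delta_self, arcCurry_delta_of_ne (by simp), map_zero, sub_zero,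
      iverson_of_not (by simp), zero_mul, zero_add]
    refine congrArg iverson (propext ?_)
    rw [← arcAgree_and_arcTau_eq_iff (p := lastMark (arcLetter m t) m), letterTau, signVal]
    simp only [Option.isSome_some, true_and, add_comm (1 : ℤ), add_left_inj]
  · rw [kinkDiff_minus, arcCurry_delta_self, arcCurry_delta_of_ne (by simp), map_zero, sub_zero,
      iverson_of_not (by simp), zero_mul, zero_add, lastX_delta_apply, letterTau, signVal]
    refine congrArg iverson (propext ?_)
    grind

theorem kinkDiff_delta_some (ε : CircleSign) (l' : Option CircleSign) (t t' : ArcWord m) :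
    kinkDiff (arcDiff m) (lastX m) (arcCurry m (delta (some ε, t))) l' t' =
      -(iverson (some ε = l') * arcDiff m (delta t) t') := by
  have hdiff : arcDiff m (arcCurry m (delta (some ε, t)) l') t' =
      iverson (some ε = l') * arcDiff m (delta t) t' := by
    rcases eq_or_ne (some ε) l' with rfl | h
    · rw [arcCurry_delta_self, iverson_of_true rfl, one_mul]
    · rw [arcCurry_delta_of_ne h, map_zero, iverson_of_not h, zero_mul, Pi.zero_apply]
  have hnone : arcCurry m (delta (some ε, t)) none = 0 := arcCurry_delta_of_ne (by simp) t
  rw [← hdiff]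
  rcases l' with _ | _ | _
  · rw [kinkDiff_none, hnone, map_zero, Pi.zero_apply, neg_zero]
  · rw [kinkDiff_plus, hnone, zero_sub, Pi.neg_apply]
  · rw [kinkDiff_minus, hnone, map_zero, zero_sub, Pi.neg_apply]

theorem arcDiff_delta_succ (l l' : Option CircleSign) (t t' : ArcWord m) :
    arcDiff (m + 1) (delta (l, t)) (l', t') =
      iverson (l = l') * (letterSigma l * arcDiff m (delta t) t') +
        iverson (ArcIncident (m + 1) m (l, t) (l', t')) := by
  rcases l with _ | ε
  · rw [letterSigma, one_mul]
    exact kinkDiff_delta_none l' t t'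
  · rw [arcIncident_last, iverson_of_not (P := _ ∧ _) fun h => Option.some_ne_none ε h.1, add_zero,
      letterSigma, neg_one_mul, mul_neg]
    exact kinkDiff_delta_some ε l' t t'

theorem iverson_and (P Q : Prop) : iverson (P ∧ Q) = iverson P * iverson Q := by
  by_cases hP : P <;> by_cases hQ : Q <;> simp [iverson, hP, hQ]

theorem arcDiff_delta_apply : ∀ {m} (t t' : ArcWord m), arcDiff m (delta t) t' =
    ∑ v ∈ Finset.range m, iverson (ArcIncident m v t t') * (-1) ^ marksAfter m (arcLetter m t) v
  | 0, _, _ => rfl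
  | m + 1, (l, t), (l', t') => by
    rw [Finset.sum_range_succ, marksAfter_last, pow_zero, mul_one]
    refine (arcDiff_delta_succ l l' t t').trans (congrArg (· + _) ?_)
    rw [arcDiff_delta_apply, Finset.mul_sum, Finset.mul_sum]
    refine Finset.sum_congr rfl fun v hv => ?_
    have hv : v < m := Finset.mem_range.1 hv
    rw [arcIncident_of_lt hv, neg_one_pow_marksAfter_succ _ hv, arcLetter, update_self,
      marksAfter_update, iverson_and]
    ring

theorem cyclicMark_succ_of_none (h : w n = none) : cyclicMark (n + 1) w v = cyclicMark n w v := by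
  rw [cyclicMark, lastMark_succ_of_none h, cyclicMark]

theorem cyclicMark_update (w : ℕ → Option CircleSign) (h : v ≤ n) (ε : CircleSign) :
    cyclicMark (n + 1) (update w n (some ε)) v = some ((lastMark w v).getD n) := by
  rw [cyclicMark, lastMark_update_of_le _ h, lastMark_succ_of_isSome (by rw [update_self]; rfl)]
  cases lastMark w v <;> rfl

theorem torusIncident_inl_inl (v : ℕ) (c c' : TorusWord n) :
    TorusIncident (n + 1) v (Sum.inl c) (Sum.inl c') ↔ TorusIncident n v c c' := by
  simp only [TorusIncident, torusLetter, cyclicMark_succ_of_none (torusLetter_of_le c le_rfl)]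
  rfl

theorem torusIncident_inl_inr_last (c : TorusWord n) (t : ArcWord n) :
    TorusIncident (n + 1) n (Sum.inl c) (Sum.inr t) ↔
      AgreeOff (lastMark (torusLetter n c) n) (torusLetter n c) (arcLetter n t) ∧
        arcTau n t = torusTau n c + 1 := by
  have hc : torusLetter n c n = none := torusLetter_of_le c le_rfl
  have hw : update (arcLetter n t) n none = arcLetter n t := by
    rw [← arcLetter_of_le t le_rfl, update_eq_self]
  simp only [TorusIncident, torusLetter, cyclicMark, lastMark_succ_of_none hc, update_idem, hw, hc,
    update_self, Option.or_self, torusTau, Option.isSome_some, true_and, and_comm]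

theorem torusIncident_inl_inr_of_lt (h : v < n) (c : TorusWord n) (t : ArcWord n) :
    ¬TorusIncident (n + 1) v (Sum.inl c) (Sum.inr t) := by
  intro ⟨_, _, _, hagree⟩
  have hn := (hagree n).1
  simp only [torusLetter] at hn
  rw [torusLetter_of_le c le_rfl, update_of_ne h.ne', update_self] at hn
  exact Bool.noConfusion hn

theorem torusIncident_inr_inl (v : ℕ) (t : ArcWord n) (c : TorusWord n) :
    ¬TorusIncident (n + 1) v (Sum.inr t) (Sum.inl c) := by
  intro ⟨hv, _, _, hagree⟩
  have hn := (hagree n).1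
  simp only [torusLetter] at hv hn
  obtain rfl | hvn := eq_or_ne v n
  · rw [update_self] at hv
    exact Option.some_ne_none _ hv
  · rw [update_self, update_of_ne hvn.symm, torusLetter_of_le c le_rfl] at hn
    exact Bool.noConfusion hn

theorem torusIncident_inr_inr_last (t t' : ArcWord n) :
    ¬TorusIncident (n + 1) n (Sum.inr t) (Sum.inr t') := by
  intro ⟨hn, _⟩
  simp only [torusLetter, update_self] at hn
  exact Option.some_ne_none _ hn

theorem torusIncident_inr_inr (h : v < n) (t t' : ArcWord n) :
    TorusIncident (n + 1) v (Sum.inr t) (Sum.inr t') ↔ ArcIncident n v t t' := by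
  simp only [TorusIncident, torusLetter, cyclicMark_update _ h.le, torusTau, ArcIncident]
  rw [update_of_ne h.ne, update_of_ne h.ne, update_comm h.ne',
    agreeOff_update (arcLetter_of_le t le_rfl)
      (by rw [update_of_ne h.ne', arcLetter_of_le t' le_rfl])]
  refine and_congr_right fun _ => and_congr_right fun _ => and_congr_right fun _ => ?_
  rcases hu : lastMark (arcLetter n t) v with _ | u
  · have hn : arcLetter n t n = update (arcLetter n t') v none n := by
      rw [update_of_ne h.ne', arcLetter_of_le t le_rfl, arcLetter_of_le t' le_rfl]
    simp [agreeOff_none_iff, agreeOff_some_iff hn]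
  · have hun : u ≠ n := ((lt_of_lastMark hu).trans h).ne
    simp [hun, and_comm]

theorem torusDiff_succ_inl (z : TorusWord (n + 1) → ℤ) (c : TorusWord n) :
    torusDiff (n + 1) z (Sum.inl c) = torusDiff n (torusSplit n z).1 c := rfl

theorem torusDiff_succ_inr (z : TorusWord (n + 1) → ℤ) (t : ArcWord n) :
    torusDiff (n + 1) z (Sum.inr t) =
      closeUp n (torusSplit n z).1 t - arcDiff n (torusSplit n z).2 t := rfl

theorem torusDiff_delta_apply : ∀ {n} (c c' : TorusWord n), torusDiff n (delta c) c' =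
    ∑ v ∈ Finset.range n,
      iverson (TorusIncident n v c c') * (-1) ^ marksAfter n (torusLetter n c) v
  | 0, _, _ => rfl
  | n + 1, Sum.inl c, Sum.inl c' => by
    rw [torusDiff_succ_inl, torusSplit_delta_inl, torusDiff_delta_apply, Finset.sum_range_succ,
      iverson_of_not fun h => Bool.noConfusion ((congrArg Option.isSome
        (torusLetter_of_le c' le_rfl)).symm.trans h.2.1), zero_mul, add_zero]
    refine Finset.sum_congr rfl fun v hv => ?_
    have hc : torusLetter n c n = none := torusLetter_of_le c le_rfl
    rw [torusIncident_inl_inl, neg_one_pow_marksAfter_succ _ (Finset.mem_range.1 hv)]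
    simp only [torusLetter, hc, letterSigma, one_mul]
  | n + 1, Sum.inl c, Sum.inr t => by
    rw [torusDiff_succ_inr, torusSplit_delta_inl, map_zero, closeUp_delta_apply,
      Finset.sum_range_succ, torusIncident_inl_inr_last, marksAfter_last, pow_zero, mul_one,
      Finset.sum_eq_zero, zero_add]
    · exact sub_zero _
    · intro v hv
      rw [iverson_of_not (torusIncident_inl_inr_of_lt (Finset.mem_range.1 hv) c t), zero_mul]
  | n + 1, Sum.inr t, Sum.inl c => by
    rw [torusDiff_succ_inl, torusSplit_delta_inr, map_zero, Finset.sum_eq_zero]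
    · rfl
    · intro v _
      rw [iverson_of_not (torusIncident_inr_inl v t c), zero_mul]
  | n + 1, Sum.inr t, Sum.inr t' => by
    rw [torusDiff_succ_inr, torusSplit_delta_inr, map_zero, arcDiff_delta_apply,
      Finset.sum_range_succ, iverson_of_not (torusIncident_inr_inr_last t t'), zero_mul, add_zero,
      Pi.zero_apply, zero_sub, ← Finset.sum_neg_distrib]
    refine Finset.sum_congr rfl fun v hv => ?_
    have hv : v < n := Finset.mem_range.1 hv
    rw [torusIncident_inr_inr hv, neg_one_pow_marksAfter_succ _ hv]
    simp only [torusLetter]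
    rw [marksAfter_update, update_self, letterSigma]
    ring

/-- The sign at a place: `inl i` is the place of the circle above the crossing `i` if its marker is
`B`, and `inr b` that of the left or right circle if all markers are `A`. -/
def torusSign (n : ℕ) (c : TorusWord n) : ℕ ⊕ Bool → Option CircleSign :=
  Sum.elim (torusLetter n c) (torusSide n c)

theorem isSome_torusSide_iff : ∀ {n} (c : TorusWord n) (b : Bool),
    (torusSide n c b).isSome ↔ ∀ i, torusLetter n c i = none
  | 0, _, _ => iff_of_true rfl fun _ => rfl
  | _ + 1, Sum.inl c, b => isSome_torusSide_iff c b
  | n + 1, Sum.inr t, b => by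
    refine iff_of_false Bool.noConfusion fun h => Option.some_ne_none (arcBase n t) ?_
    simpa only [torusLetter, update_self] using h n

theorem sum_range_succ_update (f : Option CircleSign → ℤ) (n : ℕ) (w : ℕ → Option CircleSign)
    (l : Option CircleSign) :
    ∑ i ∈ Finset.range (n + 1), f (update w n l i) = ∑ i ∈ Finset.range n, f (w i) + f l := by
  rw [Finset.sum_range_succ, update_self, Finset.sum_congr rfl fun i hi => ?_]
  rw [update_of_ne (Finset.mem_range.1 hi).ne]

theorem arcSigma_eq_sum : ∀ {m} (t : ArcWord m),
    arcSigma m t = ∑ i ∈ Finset.range m, letterSigma (arcLetter m t i)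
  | 0, _ => rfl
  | m + 1, (l, t) => by
    rw [arcLetter, sum_range_succ_update, arcSigma, arcSigma_eq_sum, add_comm]

theorem arcTau_eq_sum : ∀ {m} (t : ArcWord m),
    arcTau m t = ∑ i ∈ Finset.range m, letterTau (arcLetter m t i) + signVal (arcBase m t)
  | 0, _ => (zero_add _).symm
  | m + 1, (l, t) => by
    rw [arcLetter, sum_range_succ_update, arcTau, arcTau_eq_sum, arcBase]
    ring

theorem torusSigma_eq_sum : ∀ {n} (c : TorusWord n),
    torusSigma n c = ∑ i ∈ Finset.range n, letterSigma (torusLetter n c i)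
  | 0, _ => rfl
  | n + 1, Sum.inl c => by
    rw [torusLetter, Finset.sum_range_succ, torusLetter_of_le c le_rfl, torusSigma,
      torusSigma_eq_sum, letterSigma, add_comm]
  | n + 1, Sum.inr t => by
    rw [torusLetter, sum_range_succ_update, torusSigma, arcSigma_eq_sum, letterSigma, add_comm]

theorem torusTau_eq_sum : ∀ {n} (c : TorusWord n),
    torusTau n c = ∑ p ∈ (Finset.range n).disjSum Finset.univ, letterTau (torusSign n c p)
  | 0, (ε, ε') => by
    rw [Finset.sum_disjSum, Fintype.sum_bool, torusTau, add_comm (signVal ε)]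
    exact (zero_add _).symm
  | n + 1, Sum.inl c => by
    have hn : letterTau (torusLetter n c n) = 0 := by rw [torusLetter_of_le c le_rfl, letterTau]
    rw [torusTau, torusTau_eq_sum, Finset.sum_disjSum, Finset.sum_disjSum]
    simp only [torusSign, Sum.elim_inl, torusLetter, Finset.sum_range_succ, hn, add_zero]
    rfl
  | n + 1, Sum.inr t => by
    have hnone : letterTau none = 0 := rfl
    rw [torusTau, arcTau_eq_sum, Finset.sum_disjSum]
    simp only [torusSign, Sum.elim_inl, Sum.elim_inr, torusLetter, torusSide, hnone,
      sum_range_succ_update, Finset.sum_const_zero, add_zero]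
    rfl

theorem torusSign_injective : ∀ {n}, Injective (torusSign n)
  | 0, (ε₀, ε₁), (ε₀', ε₁'), h => Prod.ext
    (Option.some.inj (congrFun h (Sum.inr false))) (Option.some.inj (congrFun h (Sum.inr true)))
  | n + 1, Sum.inl c, Sum.inl c', h => congrArg Sum.inl (torusSign_injective h)
  | n + 1, Sum.inl c, Sum.inr t, h => by
    have hn := congrFun h (Sum.inl n)
    simp only [torusSign, Sum.elim_inl, torusLetter, update_self,
      torusLetter_of_le c le_rfl] at hn
    exact absurd hn.symm (Option.some_ne_none _)
  | n + 1, Sum.inr t, Sum.inl c, h => by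
    have hn := congrFun h (Sum.inl n)
    simp only [torusSign, Sum.elim_inl, torusLetter, update_self,
      torusLetter_of_le c le_rfl] at hn
    exact absurd hn (Option.some_ne_none _)
  | n + 1, Sum.inr t, Sum.inr t', h => by
    have hw : torusLetter (n + 1) (Sum.inr t) = torusLetter (n + 1) (Sum.inr t') :=
      funext fun i => congrFun h (Sum.inl i)
    rw [← agreeOff_none_iff, torusLetter, torusLetter,
      agreeOff_update (arcLetter_of_le t le_rfl) (arcLetter_of_le t' le_rfl),
      agreeOff_none_iff] at hw
    refine congrArg Sum.inr ((arcAgree_some_iff le_rfl).1 ⟨?_, fun _ => ?_⟩)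
    · exact fun u => ⟨by rw [hw.2], fun _ => congrFun hw.2 u⟩
    · exact Option.some.inj (hw.1.2 (Option.some_ne_none n).symm)

theorem exists_arcWord (w : ℕ → Option CircleSign) (ε : CircleSign) : ∀ m,
    ∃ t, (∀ i < m, arcLetter m t i = w i) ∧ arcBase m t = ε
  | 0 => ⟨ε, fun _ h => absurd h (Nat.not_lt_zero _), rfl⟩
  | m + 1 => by
    obtain ⟨t, ht, hε⟩ := exists_arcWord w ε m
    refine ⟨(w m, t), fun i hi => ?_, hε⟩
    rcases (Nat.lt_succ_iff.1 hi).eq_or_lt with rfl | hi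
    · exact update_self ..
    · exact (update_of_ne hi.ne ..).trans (ht i hi)

theorem exists_torusWord (w : ℕ → Option CircleSign) (q : Bool → CircleSign) : ∀ n,
    ∃ c, (∀ i < n, torusLetter n c i = w i) ∧ ∀ b, torusSide n c b ≠ none → torusSide n c b = q b
  | 0 => ⟨(q false, q true), fun _ h => absurd h (Nat.not_lt_zero _), by rintro (_ | _) - <;> rfl⟩
  | n + 1 => by
    rcases hw : w n with _ | ε
    · obtain ⟨c, hc, hq⟩ := exists_torusWord w q n
      refine ⟨Sum.inl c, fun i hi => ?_, hq⟩
      rcases (Nat.lt_succ_iff.1 hi).eq_or_lt with rfl | hi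
      · exact (torusLetter_of_le c le_rfl).trans hw.symm
      · exact hc i hi
    · obtain ⟨t, ht, rfl⟩ := exists_arcWord w ε n
      refine ⟨Sum.inr t, fun i hi => ?_, fun b hb => absurd rfl hb⟩
      rcases (Nat.lt_succ_iff.1 hi).eq_or_lt with rfl | hi
      · exact (update_self ..).trans hw.symm
      · exact (update_of_ne hi.ne ..).trans (ht i hi)

end Letters

end Khovanov

namespace PDCode

variable {X E : Type}

theorem eq_of_circleOf_eq (D : PDCode X E) {s : X → Marker} {α : Type*} (f : E → α)
    (hf : ∀ e e', D.Arc s e e' → f e = f e') {e e' : E} (h : D.circleOf s e = D.circleOf s e') :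
    f e = f e' :=
  congrArg (Quot.lift f fun a b hab => by
    induction (hab : Relation.EqvGen (D.Arc s) a b) with
    | rel _ _ h => exact hf _ _ h
    | refl => rfl
    | symm _ _ _ ih => exact ih.symm
    | trans _ _ _ _ _ ih ih' => exact ih.trans ih') h

/-- The function on circles given by a function on edges that is constant along arcs. -/
def circleLift (D : PDCode X E) (s : X → Marker) {α : Type*} (f : E → α)
    (hf : ∀ e e', D.Arc s e e' → f e = f e') : D.Circle s → α :=
  Quotient.lift f fun _ _ h => D.eq_of_circleOf_eq f hf (Quotient.sound h)

theorem circleOf_eq_of_arc (D : PDCode X E) {s : X → Marker} {e e' : E} (h : D.Arc s e e') :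
    D.circleOf s e = D.circleOf s e' :=
  Quotient.sound (Relation.EqvGen.rel _ _ h)

theorem enhancedState_ext {D : PDCode X E} {S S' : D.EnhancedState} (h : S.1 = S'.1)
    (h' : ∀ e, S.2 (D.circleOf S.1 e) = S'.2 (D.circleOf S'.1 e)) : S = S' := by
  obtain ⟨s, f⟩ := S
  obtain ⟨s', f'⟩ := S'
  obtain rfl : s = s' := h
  congr 1
  funext c
  induction c using Quotient.inductionOn with
  | h e => exact h' e

theorem tau_eq_sum {D : PDCode X E} (S : D.EnhancedState) [Fintype (D.Circle S.1)] :
    tau S = ∑ x, Khovanov.signVal (S.2 x) := by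
  have h (x) : Khovanov.signVal (S.2 x) =
      (if S.2 x = CircleSign.plus then 1 else 0) - if S.2 x = CircleSign.minus then 1 else 0 := by
    rcases S.2 x with _ | _ <;> rfl
  simp only [h, tau, Finset.sum_sub_distrib, Finset.sum_boole, Nat.card_eq_fintype_card,
    Fintype.card_subtype]

end PDCode

namespace Khovanov

open CircleSign PDCode

section Marks

variable {n v j u : ℕ} {w w' : ℕ → Option CircleSign}

theorem isSome_of_lastMark : ∀ {j}, lastMark w j = some u → (w u).isSome
  | j + 1, h => by
    rw [lastMark] at h
    split_ifs at h with hj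
    · exact Option.some.inj h ▸ hj
    · exact isSome_of_lastMark h

theorem lastMark_eq_none_iff : ∀ {j}, lastMark w j = none ↔ ∀ i < j, w i = none
  | 0 => iff_of_true rfl fun _ h => absurd h (Nat.not_lt_zero _)
  | j + 1 => by
    rw [Nat.forall_lt_succ_right, ← lastMark_eq_none_iff, lastMark]
    rcases w j with _ | _ <;> simp

theorem cyclicMark_eq_some (h : cyclicMark n w j = some u) :
    lastMark w j = some u ∨ lastMark w j = none ∧ lastMark w n = some u :=
  Option.or_eq_some_iff.1 h

theorem cyclicMark_eq_none_iff (hj : j ≤ n) : cyclicMark n w j = none ↔ ∀ i < n, w i = none := by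
  rw [cyclicMark, Option.or_eq_none_iff, lastMark_eq_none_iff, lastMark_eq_none_iff]
  exact and_iff_right_of_imp fun h i hi => h i (hi.trans_le hj)

theorem isSome_of_cyclicMark (h : cyclicMark n w j = some u) : (w u).isSome :=
  (cyclicMark_eq_some h).elim isSome_of_lastMark fun h => isSome_of_lastMark h.2

theorem lt_of_cyclicMark (hj : j ≤ n) (h : cyclicMark n w j = some u) : u < n :=
  (cyclicMark_eq_some h).elim (fun h => (lt_of_lastMark h).trans_le hj) fun h => lt_of_lastMark h.2

theorem cyclicMark_mod (h : j ≤ n) : cyclicMark n w (j % n) = cyclicMark n w j := by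
  rcases h.lt_or_eq with h | rfl
  · rw [Nat.mod_eq_of_lt h]
  · rw [Nat.mod_self]
    exact Option.or_self.symm

theorem cyclicMark_add_one_of_none (h : w v = none) :
    cyclicMark n w (v + 1) = cyclicMark n w v := by
  rw [cyclicMark, lastMark_succ_of_none h, cyclicMark]

theorem cyclicMark_add_one_of_isSome (h : (w v).isSome) : cyclicMark n w (v + 1) = some v := by
  rw [cyclicMark, lastMark_succ_of_isSome h]
  rfl

theorem lastMark_of_insert (hv : w v = none) (hv' : (w' v).isSome)
    (h : ∀ u, u ≠ v → (w u).isSome = (w' u).isSome) : ∀ {j}, v < j →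
      ∃ u, lastMark w' j = some u ∧
        (lastMark w j = some u ∨ u = v ∧ lastMark w j = lastMark w v)
  | j + 1, hj => by
    rcases eq_or_ne j v with rfl | hjv
    · exact ⟨j, lastMark_succ_of_isSome hv', Or.inr ⟨rfl, lastMark_succ_of_none hv⟩⟩
    · rw [lastMark, lastMark, ← h j hjv]
      split_ifs
      · exact ⟨j, rfl, Or.inl rfl⟩
      · exact lastMark_of_insert hv hv' h (by omega)

theorem cyclicMark_of_insert (hvn : v < n) (hv : w v = none) (hv' : (w' v).isSome)
    (h : ∀ u, u ≠ v → (w u).isSome = (w' u).isSome) (hj : cyclicMark n w v ≠ cyclicMark n w j) :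
    cyclicMark n w' j = cyclicMark n w j := by
  rcases lt_or_ge v j with hvj | hvj
  · obtain ⟨u, hu, hu' | ⟨rfl, hu'⟩⟩ := lastMark_of_insert hv hv' h hvj
    · rw [cyclicMark, cyclicMark, hu, hu', Option.some_or, Option.some_or]
    · exact absurd (by rw [cyclicMark, cyclicMark, hu']) hj
  · have hl : lastMark w j = lastMark w' j := lastMark_congr fun i hi => h i (hi.trans_le hvj).ne
    rcases hlj : lastMark w j with _ | u
    · obtain ⟨u, hu, hu' | ⟨rfl, hu'⟩⟩ := lastMark_of_insert hv hv' h hvn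
      · rw [cyclicMark, cyclicMark, ← hl, hlj, hu, hu']
      · refine absurd ?_ hj
        rw [cyclicMark, cyclicMark, hlj, ← hu', Option.or_self, Option.none_or]
    · rw [cyclicMark, cyclicMark, ← hl, hlj, Option.some_or, Option.some_or]

end Marks

section Diagram

variable {n : ℕ}

/-- The edge at the side `b` that enters the crossing `j` of the closed braid from below, with `j`
taken modulo `n`. -/
def braidEdge (hn : 0 < n) (j : ℕ) (b : Bool) : Fin n × Bool :=
  (⟨j % n, Nat.mod_lt _ hn⟩, b)

theorem braidEdge_coe (hn : 0 < n) (v : Fin n) (b : Bool) : braidEdge hn v b = (v, b) :=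
  Prod.ext (Fin.ext (Nat.mod_eq_of_lt v.2)) rfl

theorem braidEdge_self (hn : 0 < n) (b : Bool) : braidEdge hn n b = braidEdge hn 0 b := by
  simp only [braidEdge, Nat.mod_self, Nat.zero_mod]

theorem braidEdge_succ (hn : 0 < n) (v : Fin n) (b : Bool) :
    braidEdge hn (v + 1) b = (finRotate n v, b) := by
  obtain ⟨k, rfl⟩ : ∃ k, n = k + 1 := ⟨n - 1, by omega⟩
  rw [finRotate_apply]
  refine Prod.ext (Fin.ext ?_) rfl
  simp [braidEdge, Fin.val_add]

theorem torusLinkDiagram_label (hn : 0 < n) (v : Fin n) : (torusLinkDiagram n).label v =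
    ![braidEdge hn v true, braidEdge hn (v + 1) true, braidEdge hn (v + 1) false,
      braidEdge hn v false] := by
  rw [braidEdge_coe, braidEdge_coe, braidEdge_succ, braidEdge_succ]
  rfl

theorem eq_of_arc (hn : 0 < n) {s : Fin n → Marker} {α : Type*} {f : Fin n × Bool → α}
    (hA : ∀ v : Fin n, s v = Marker.A → ∀ b, f (braidEdge hn (v + 1) b) = f (braidEdge hn v b))
    (hB : ∀ v : Fin n, s v = Marker.B → ∀ j, f (braidEdge hn j true) = f (braidEdge hn j false))
    (e e' : Fin n × Bool) (h : (torusLinkDiagram n).Arc s e e') : f e = f e' := by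
  obtain ⟨v, ⟨hs, ⟨rfl, rfl⟩ | ⟨rfl, rfl⟩⟩ | ⟨hs, ⟨rfl, rfl⟩ | ⟨rfl, rfl⟩⟩⟩ := h <;>
    rw [torusLinkDiagram_label hn]
  · exact (hA v hs true).symm
  · exact hA v hs false
  · exact hB v hs v
  · exact hB v hs (v + 1)

theorem circleOf_of_A (hn : 0 < n) {s : Fin n → Marker} {v : Fin n} (hs : s v = Marker.A)
    (b : Bool) :
    (torusLinkDiagram n).circleOf s (braidEdge hn (v + 1) b) =
      (torusLinkDiagram n).circleOf s (braidEdge hn v b) := by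
  cases b
  · refine circleOf_eq_of_arc _ ⟨v, Or.inl ⟨hs, Or.inr ⟨?_, ?_⟩⟩⟩ <;>
      rw [torusLinkDiagram_label hn] <;> rfl
  · refine (circleOf_eq_of_arc _ ⟨v, Or.inl ⟨hs, Or.inl ⟨?_, ?_⟩⟩⟩).symm <;>
      rw [torusLinkDiagram_label hn] <;> rfl

theorem circleOf_of_B (hn : 0 < n) {s : Fin n → Marker} {v : Fin n} (hs : s v = Marker.B)
    (b : Bool) :
    (torusLinkDiagram n).circleOf s (braidEdge hn (v + 1) b) =
      (torusLinkDiagram n).circleOf s (braidEdge hn (v + 1) true) := by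
  cases b
  · refine (circleOf_eq_of_arc _ ⟨v, Or.inr ⟨hs, Or.inr ⟨?_, ?_⟩⟩⟩).symm <;>
      rw [torusLinkDiagram_label hn] <;> rfl
  · rfl

/-- The state that puts the marker `B` on the crossings that carry a sign. -/
def markerOf (w : ℕ → Option CircleSign) (v : Fin n) : Marker :=
  if (w v).isSome then Marker.B else Marker.A

variable {w w' : ℕ → Option CircleSign}

theorem markerOf_eq_A {v : Fin n} : markerOf w v = Marker.A ↔ w v = none := by
  rw [markerOf]
  rcases w v with _ | _ <;> simp

theorem markerOf_eq_B {v : Fin n} : markerOf w v = Marker.B ↔ (w v).isSome := by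
  rw [markerOf]
  rcases w v with _ | _ <;> simp

theorem markerOf_eq_iff {v : Fin n} :
    markerOf w v = markerOf w' v ↔ (w v).isSome = (w' v).isSome := by
  rw [markerOf, markerOf]
  rcases w v with _ | _ <;> rcases w' v with _ | _ <;> simp

/-- The place of the circle through an edge, in the convention of `torusSign`. -/
def circlePlace (w : ℕ → Option CircleSign) (e : Fin n × Bool) : ℕ ⊕ Bool :=
  (cyclicMark n w e.1).elim (Sum.inr e.2) Sum.inl

/-- An edge on the circle at a place. -/
def placeEdge (hn : 0 < n) : ℕ ⊕ Bool → Fin n × Bool :=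
  Sum.elim (fun u => braidEdge hn (u + 1) true) (braidEdge hn 0)

theorem circlePlace_of_some {e : Fin n × Bool} {u : ℕ} (h : cyclicMark n w e.1 = some u) :
    circlePlace w e = Sum.inl u := by
  rw [circlePlace, h, Option.elim_some]

theorem circlePlace_of_none {e : Fin n × Bool} (h : cyclicMark n w e.1 = none) :
    circlePlace w e = Sum.inr e.2 := by
  rw [circlePlace, h, Option.elim_none]

theorem circlePlace_eq_iff {e e' : Fin n × Bool} : circlePlace w e = circlePlace w e' ↔
    cyclicMark n w e.1 = cyclicMark n w e'.1 ∧ (cyclicMark n w e.1 = none → e.2 = e'.2) := by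
  rw [circlePlace, circlePlace]
  rcases cyclicMark n w e.1 with _ | u <;> rcases cyclicMark n w e'.1 with _ | u' <;> simp

theorem circlePlace_arc (hn : 0 < n) (e e' : Fin n × Bool)
    (h : (torusLinkDiagram n).Arc (markerOf w) e e') : circlePlace w e = circlePlace w e' := by
  refine eq_of_arc hn (fun v hv b => ?_) (fun v hv j => ?_) e e' h
  · refine circlePlace_eq_iff.2 ⟨?_, fun _ => rfl⟩
    rw [braidEdge, braidEdge, cyclicMark_mod v.2, cyclicMark_mod v.2.le,
      cyclicMark_add_one_of_none (markerOf_eq_A.1 hv)]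
  · refine circlePlace_eq_iff.2 ⟨rfl, fun hnone => ?_⟩
    have hw := (cyclicMark_eq_none_iff (Nat.mod_lt j hn).le).1 hnone v v.2
    exact absurd (markerOf_eq_A.2 hw) (by simp [hv])

theorem circleOf_of_lastMark (hn : 0 < n) (w : ℕ → Option CircleSign) (b : Bool) :
    ∀ {j}, j ≤ n → (torusLinkDiagram n).circleOf (markerOf w) (braidEdge hn j b) =
      (torusLinkDiagram n).circleOf (markerOf w)
        (braidEdge hn ((lastMark w j).elim 0 Nat.succ) b)
  | 0, _ => rfl
  | j + 1, hj => by
    rcases hw : w j with _ | ε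
    · rw [lastMark_succ_of_none hw, circleOf_of_A hn (v := ⟨j, hj⟩) (markerOf_eq_A.2 hw) b]
      exact circleOf_of_lastMark hn w b (Nat.le_of_succ_le hj)
    · rw [lastMark_succ_of_isSome (by rw [hw]; rfl)]
      rfl

theorem circleOf_placeEdge_circlePlace (hn : 0 < n) (w : ℕ → Option CircleSign)
    (e : Fin n × Bool) :
    (torusLinkDiagram n).circleOf (markerOf w) (placeEdge hn (circlePlace w e)) =
      (torusLinkDiagram n).circleOf (markerOf w) e := by
  obtain ⟨j, b⟩ := e
  have hj := circleOf_of_lastMark hn w b j.2.le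
  rw [braidEdge_coe] at hj
  rcases hu : cyclicMark n w j with _ | u
  · rw [circlePlace_of_none hu, hj, (Option.or_eq_none_iff.1 hu).1]
    rfl
  · have hB := circleOf_of_B hn (markerOf_eq_B (v := ⟨u, lt_of_cyclicMark j.2.le hu⟩).2
      (isSome_of_cyclicMark hu)) b
    rw [circlePlace_of_some hu, hj]
    refine hB.symm.trans ?_
    rcases cyclicMark_eq_some hu with h | ⟨h, h'⟩
    · rw [h]
      rfl
    · rw [h]
      refine Eq.trans ?_ ((circleOf_of_lastMark hn w b le_rfl).symm.trans ?_)
      · rw [h']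
        rfl
      · rw [braidEdge_self]
        rfl

theorem circleOf_eq_iff (hn : 0 < n) {e e' : Fin n × Bool} :
    (torusLinkDiagram n).circleOf (markerOf w) e = (torusLinkDiagram n).circleOf (markerOf w) e' ↔
      circlePlace w e = circlePlace w e' := by
  refine ⟨eq_of_circleOf_eq _ _ (circlePlace_arc hn), fun h => ?_⟩
  rw [← circleOf_placeEdge_circlePlace hn w e, h, circleOf_placeEdge_circlePlace]

theorem lt_of_isSome_torusLetter {c : TorusWord n} {u : ℕ} (h : (torusLetter n c u).isSome) :
    u < n := by
  by_contra hu
  rw [torusLetter_of_le c (not_lt.1 hu)] at h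
  exact Bool.noConfusion h

theorem isSome_torusSign_circlePlace (c : TorusWord n) (e : Fin n × Bool) :
    (torusSign n c (circlePlace (torusLetter n c) e)).isSome := by
  rcases hu : cyclicMark n (torusLetter n c) e.1 with _ | u
  · rw [circlePlace_of_none hu]
    refine (isSome_torusSide_iff c e.2).2 fun i => ?_
    rcases lt_or_ge i n with hi | hi
    · exact (cyclicMark_eq_none_iff e.1.2.le).1 hu i hi
    · exact torusLetter_of_le c hi
  · rw [circlePlace_of_some hu]
    exact isSome_of_cyclicMark hu

theorem circlePlace_placeEdge (hn : 0 < n) {c : TorusWord n} : ∀ {p},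
    (torusSign n c p).isSome → circlePlace (torusLetter n c) (placeEdge hn p) = p
  | Sum.inl _, h => circlePlace_of_some <| (cyclicMark_mod (lt_of_isSome_torusLetter h)).trans
    (cyclicMark_add_one_of_isSome h)
  | Sum.inr b, h => circlePlace_of_none <| (cyclicMark_eq_none_iff (Nat.mod_lt _ hn).le).2
    fun i _ => (isSome_torusSide_iff c b).1 h i

/-- The sign of the circle through an edge. -/
def edgeSign (c : TorusWord n) (e : Fin n × Bool) : CircleSign :=
  (torusSign n c (circlePlace (torusLetter n c) e)).get (isSome_torusSign_circlePlace c e)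

theorem some_edgeSign (c : TorusWord n) (e : Fin n × Bool) :
    some (edgeSign c e) = torusSign n c (circlePlace (torusLetter n c) e) :=
  Option.some_get _

theorem some_edgeSign_placeEdge (hn : 0 < n) {c : TorusWord n} {p : ℕ ⊕ Bool}
    (h : (torusSign n c p).isSome) : some (edgeSign c (placeEdge hn p)) = torusSign n c p := by
  rw [some_edgeSign, circlePlace_placeEdge hn h]

theorem edgeSign_arc (hn : 0 < n) (c : TorusWord n) (e e' : Fin n × Bool)
    (h : (torusLinkDiagram n).Arc (markerOf (torusLetter n c)) e e') :
    edgeSign c e = edgeSign c e' := by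
  apply Option.some_injective
  rw [some_edgeSign, some_edgeSign, circlePlace_arc hn e e' h]

/-- The enhanced state encoded by a word. -/
def toState (hn : 0 < n) (c : TorusWord n) : (torusLinkDiagram n).EnhancedState :=
  ⟨markerOf (torusLetter n c), circleLift _ _ (edgeSign c) (edgeSign_arc hn c)⟩

theorem toState_circleOf (hn : 0 < n) (c : TorusWord n) (e : Fin n × Bool) :
    (toState hn c).2 ((torusLinkDiagram n).circleOf (toState hn c).1 e) = edgeSign c e := rfl

theorem toState_injective (hn : 0 < n) : Function.Injective (toState hn) := by
  intro c c' h
  have hletter (i : ℕ) : (torusLetter n c i).isSome = (torusLetter n c' i).isSome := by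
    rcases lt_or_ge i n with hi | hi
    · exact markerOf_eq_iff.1 (congrFun (congrArg Sigma.fst h) ⟨i, hi⟩)
    · rw [torusLetter_of_le c hi, torusLetter_of_le c' hi]
  have hside (b : Bool) : (torusSide n c b).isSome = (torusSide n c' b).isSome := by
    rw [Bool.eq_iff_iff, isSome_torusSide_iff, isSome_torusSide_iff]
    refine forall_congr' fun i => ?_
    rw [← Option.not_isSome_iff_eq_none, ← Option.not_isSome_iff_eq_none, hletter]
  have hsome (p : ℕ ⊕ Bool) : (torusSign n c p).isSome = (torusSign n c' p).isSome :=
    p.casesOn hletter hside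
  have hedge (e : Fin n × Bool) : edgeSign c e = edgeSign c' e := by
    rw [← toState_circleOf hn, ← toState_circleOf hn, h]
  refine torusSign_injective (funext fun p => ?_)
  by_cases hp : (torusSign n c p).isSome
  · rw [← some_edgeSign_placeEdge hn hp, ← some_edgeSign_placeEdge hn (hsome p ▸ hp), hedge]
  · have hp' := hsome p ▸ hp
    rw [Option.not_isSome_iff_eq_none] at hp hp'
    rw [hp, hp']

theorem toState_surjective (hn : 0 < n) : Function.Surjective (toState hn) := by
  intro S
  let sign (p : ℕ ⊕ Bool) : CircleSign :=
    S.2 ((torusLinkDiagram n).circleOf S.1 (placeEdge hn p))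
  obtain ⟨c, hletter, hside⟩ := exists_torusWord
    (fun i => if S.1 ⟨i % n, Nat.mod_lt _ hn⟩ = Marker.B then some (sign (Sum.inl i)) else none)
    (fun b => sign (Sum.inr b)) n
  have hletter (v : Fin n) : torusLetter n c v =
      if S.1 v = Marker.B then some (sign (Sum.inl v)) else none := by
    simp only [hletter v v.2, Nat.mod_eq_of_lt v.2]
  have hmarker : markerOf (torusLetter n c) = S.1 := by
    funext v
    rcases hv : S.1 v with _ | _
    · rw [markerOf_eq_A, hletter, hv]
      rfl
    · rw [markerOf_eq_B, hletter, hv]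
      rfl
  have hsign (p : ℕ ⊕ Bool) (hp : (torusSign n c p).isSome) :
      torusSign n c p = some (sign p) := by
    rcases p with u | b
    · have hu := hletter ⟨u, lt_of_isSome_torusLetter hp⟩
      split_ifs at hu
      · exact hu
      · exact absurd hp (by simp [torusSign, hu])
    · exact hside b (Option.isSome_iff_ne_none.1 hp)
  refine ⟨c, enhancedState_ext hmarker fun e => Option.some_injective _ ?_⟩
  rw [toState_circleOf, some_edgeSign, hsign _ (isSome_torusSign_circlePlace c e)]
  have he := circleOf_placeEdge_circlePlace hn (torusLetter n c) e
  rw [hmarker] at he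
  exact congrArg some (congrArg S.2 he)

theorem sigma_toState (hn : 0 < n) (c : TorusWord n) :
    sigma (toState hn c) = torusSigma n c := by
  rw [sigma_eq_sum, torusSigma_eq_sum, Finset.sum_range]
  refine Finset.sum_congr rfl fun v _ => ?_
  change (if markerOf (torusLetter n c) v = Marker.A then (1 : ℤ) else -1) = _
  simp only [markerOf_eq_A]
  rcases torusLetter n c v with _ | _ <;> rfl

theorem tau_toState (hn : 0 < n) (c : TorusWord n) : tau (toState hn c) = torusTau n c := by
  classical
  let _ : Fintype ((torusLinkDiagram n).Circle (toState hn c).1) := Fintype.ofFinite _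
  have hzero (p) (h : letterTau (torusSign n c p) ≠ 0) : (torusSign n c p).isSome :=
    Option.isSome_iff_ne_none.2 fun hp => h (by rw [hp]; rfl)
  rw [tau_eq_sum, torusTau_eq_sum, ← Finset.sum_filter_of_ne fun p _ => hzero p]
  refine (Finset.sum_nbij (fun p => (torusLinkDiagram n).circleOf _ (placeEdge hn p))
    (fun _ _ => Finset.mem_univ _) ?_ ?_ ?_).symm
  · intro p hp p' hp' h
    rw [← circlePlace_placeEdge hn (Finset.mem_filter.1 hp).2,
      ← circlePlace_placeEdge hn (Finset.mem_filter.1 hp').2]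
    exact (circleOf_eq_iff hn).1 h
  · intro x _
    induction x using Quotient.inductionOn with
    | h e =>
      have hp := isSome_torusSign_circlePlace c e
      refine ⟨_, Finset.mem_filter.2 ⟨?_, hp⟩,
        circleOf_placeEdge_circlePlace hn (torusLetter n c) e⟩
      revert hp
      rcases circlePlace (torusLetter n c) e with u | b <;> intro hp
      · exact Finset.inl_mem_disjSum.2 (Finset.mem_range.2 (lt_of_isSome_torusLetter hp))
      · exact Finset.inr_mem_disjSum.2 (Finset.mem_univ b)
  · intro p hp
    rw [← some_edgeSign_placeEdge hn (Finset.mem_filter.1 hp).2]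
    rfl

theorem forall_circleOf_label_ne_iff (hn : 0 < n) {v : Fin n} (hv : w v = none)
    (e : Fin n × Bool) :
    (∀ i, (torusLinkDiagram n).circleOf (markerOf w) ((torusLinkDiagram n).label v i) ≠
        (torusLinkDiagram n).circleOf (markerOf w) e) ↔
      cyclicMark n w v ≠ cyclicMark n w e.1 := by
  have hA (b : Bool) := circleOf_of_A hn (s := markerOf w) (markerOf_eq_A.2 hv) b
  have hne (b : Bool) (h : cyclicMark n w v ≠ cyclicMark n w e.1) :
      (torusLinkDiagram n).circleOf (markerOf w) (braidEdge hn v b) ≠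
        (torusLinkDiagram n).circleOf (markerOf w) e := by
    rw [braidEdge_coe, Ne, circleOf_eq_iff hn, circlePlace_eq_iff]
    exact fun h' => h h'.1
  rw [torusLinkDiagram_label hn]
  constructor
  · intro h hve
    have hcircle : (torusLinkDiagram n).circleOf (markerOf w) (braidEdge hn v e.2) =
        (torusLinkDiagram n).circleOf (markerOf w) e := by
      rw [braidEdge_coe, circleOf_eq_iff hn, circlePlace_eq_iff]
      exact ⟨hve, fun _ => rfl⟩
    rcases hb : e.2 with _ | _ <;> rw [hb] at hcircle
    exacts [h 3 hcircle, h 0 hcircle]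
  · intro h i
    fin_cases i
    · exact hne true h
    · exact (hA true).trans_ne (hne true h)
    · exact (hA false).trans_ne (hne false h)
    · exact hne false h

theorem edgeSign_eq_off_iff (hn : 0 < n) {v : Fin n} {c c' : TorusWord n}
    (hv : torusLetter n c v = none) (hv' : (torusLetter n c' v).isSome)
    (h : ∀ u, u ≠ (v : ℕ) → (torusLetter n c u).isSome = (torusLetter n c' u).isSome) :
    (∀ e : Fin n × Bool, cyclicMark n (torusLetter n c) v ≠ cyclicMark n (torusLetter n c) e.1 →
        edgeSign c' e = edgeSign c e) ↔
      ∀ u, u ≠ (v : ℕ) → cyclicMark n (torusLetter n c) v ≠ some u →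
        torusLetter n c u = torusLetter n c' u := by
  constructor
  · intro he u huv hu
    by_cases hs : (torusLetter n c u).isSome
    · have hs' := h u huv ▸ hs
      have hmark : cyclicMark n (torusLetter n c) (placeEdge hn (Sum.inl u)).1 = some u :=
        (cyclicMark_mod (lt_of_isSome_torusLetter hs)).trans (cyclicMark_add_one_of_isSome hs)
      have hsign := congrArg some (he (placeEdge hn (Sum.inl u)) (hmark ▸ hu))
      rw [some_edgeSign_placeEdge hn (p := Sum.inl u) hs,
        some_edgeSign_placeEdge hn (p := Sum.inl u) hs'] at hsign
      exact hsign.symm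
    · have hs' := h u huv ▸ hs
      rw [Option.not_isSome_iff_eq_none] at hs hs'
      rw [hs, hs']
  · intro hu e he
    have hmark := cyclicMark_of_insert v.2 hv hv' h he
    rcases hue : cyclicMark n (torusLetter n c) e.1 with _ | u
    · rw [hue, Ne, cyclicMark_eq_none_iff v.2.le] at he
      exact absurd ((cyclicMark_eq_none_iff e.1.2.le).1 hue) he
    · have huv : u ≠ v := by
        rintro rfl
        exact absurd (isSome_of_cyclicMark hue) (by simp [hv])
      apply Option.some_injective
      rw [some_edgeSign, some_edgeSign, circlePlace_of_some hue,
        circlePlace_of_some (hmark.trans hue)]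
      exact (hu u huv (hue ▸ he)).symm

theorem agreeOff_update_none_iff {p : Option ℕ} {v : ℕ} (hv : w v = none) :
    AgreeOff p w (Function.update w' v none) ↔
      (∀ u, u ≠ v → (w u).isSome = (w' u).isSome) ∧ ∀ u, u ≠ v → p ≠ some u → w u = w' u := by
  rw [← forall₂_and]
  refine forall_congr' fun u => ?_
  rcases eq_or_ne u v with rfl | hu
  · simp [hv]
  · simp [hu]

theorem incidentAt_toState (hn : 0 < n) (v : Fin n) (c c' : TorusWord n) :
    (torusLinkDiagram n).IncidentAt v (toState hn c) (toState hn c') ↔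
      TorusIncident n v c c' := by
  rw [IncidentAt, TorusIncident, tau_toState, tau_toState]
  have hmarker : (∀ u : Fin n, u ≠ v → (toState hn c').1 u = (toState hn c).1 u) ↔
      ∀ u, u ≠ (v : ℕ) → (torusLetter n c u).isSome = (torusLetter n c' u).isSome := by
    refine ⟨fun h u hu => ?_, fun h u hu => ?_⟩
    · rcases lt_or_ge u n with hun | hun
      · exact (markerOf_eq_iff.1 (h ⟨u, hun⟩ fun h' => hu (congrArg Fin.val h'))).symm
      · rw [torusLetter_of_le c hun, torusLetter_of_le c' hun]
    · exact markerOf_eq_iff.2 (h u fun h' => hu (Fin.ext h')).symm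
  constructor
  · rintro ⟨hA, hB, hM, hτ, hS⟩
    have hv := markerOf_eq_A.1 hA
    have hv' := markerOf_eq_B.1 hB
    refine ⟨hv, hv', hτ, (agreeOff_update_none_iff hv).2 ⟨hmarker.1 hM, ?_⟩⟩
    exact (edgeSign_eq_off_iff hn hv hv' (hmarker.1 hM)).1 fun e he =>
      hS e ((forall_circleOf_label_ne_iff hn hv e).2 he)
  · rintro ⟨hv, hv', hτ, h⟩
    obtain ⟨hM, hS⟩ := (agreeOff_update_none_iff hv).1 h
    refine ⟨markerOf_eq_A.2 hv, markerOf_eq_B.2 hv', hmarker.2 hM, hτ, fun e he => ?_⟩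
    exact (edgeSign_eq_off_iff hn hv hv' hM).2 hS e ((forall_circleOf_label_ne_iff hn hv e).1 he)

theorem coefficient_toState (hn : 0 < n) (c c' : TorusWord n) :
    (torusLinkDiagram n).coefficient (toState hn c) (toState hn c') =
      torusDiff n (delta c) c' := by
  have hafter (v : Fin n) :
      Nat.card {u : Fin n // v < u ∧ (toState hn c).1 u = Marker.B} =
        marksAfter n (torusLetter n c) v := by
    classical
    rw [Nat.card_eq_fintype_card, Fintype.card_subtype, marksAfter, Finset.card_filter,
      Finset.card_filter, Finset.sum_range]
    exact Finset.sum_congr rfl fun u _ => if_congr (and_congr Iff.rfl markerOf_eq_B) rfl rfl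
  rw [coefficient, torusDiff_delta_apply, Finset.sum_range]
  refine Finset.sum_congr rfl fun v _ => ?_
  rw [hafter]
  by_cases h : TorusIncident n v c c'
  · rw [if_pos ((incidentAt_toState hn v c c').2 h), iverson_of_true h, one_mul]
  · rw [if_neg (mt (incidentAt_toState hn v c c').1 h), iverson_of_not h, zero_mul]

/-- The enhanced states of the diagram of `T(2, n)` as words. -/
noncomputable def stateEquiv (hn : 0 < n) :
    TorusWord n ≃ (torusLinkDiagram n).EnhancedState :=
  Equiv.ofBijective (toState hn) ⟨toState_injective hn, toState_surjective hn⟩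

/-- The chains on the diagram of `T(2, n)` as chains on words. -/
noncomputable def wordChain (hn : 0 < n) :
    ((torusLinkDiagram n).EnhancedState → ℤ) ≃ₗ[ℤ] (TorusWord n → ℤ) :=
  LinearEquiv.funCongrLeft ℤ ℤ (stateEquiv hn)

theorem wordChain_totalDiff (hn : 0 < n) (z : (torusLinkDiagram n).EnhancedState → ℤ) :
    wordChain hn ((torusLinkDiagram n).totalDiff z) = torusDiff n (wordChain hn z) := by
  classical
  let _ : Fintype (TorusWord n) := Fintype.ofEquiv _ (stateEquiv hn).symm
  funext c'
  rw [LinearMap.pi_apply_eq_sum_univ (torusDiff n), Finset.sum_apply]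
  refine (Fintype.sum_equiv (stateEquiv hn) _ _ fun c => ?_).symm
  rw [Pi.smul_apply, smul_eq_mul]
  refine congrArg (z (toState hn c) * ·) (Eq.trans ?_ (coefficient_toState hn c c').symm)
  exact congrArg (torusDiff n · c') (funext fun j => by rw [delta, iverson])

theorem totalDiff_mul_self (hn : 0 < n) :
    (torusLinkDiagram n).totalDiff * (torusLinkDiagram n).totalDiff = 0 := by
  refine LinearMap.ext fun z => (wordChain hn).injective ?_
  rw [Module.End.mul_apply, wordChain_totalDiff, wordChain_totalDiff, LinearMap.zero_apply,
    map_zero]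
  exact LinearMap.congr_fun (torusDiff_mul_self n) _

theorem isAcyclicSurjection_totalDiff (hn : 0 < n) :
    IsAcyclicSurjection (torusLinkDiagram n).totalDiff (reducedDiff n)
      (torusAug n ∘ₗ (wordChain hn).toLinearMap) :=
  (isAcyclicSurjection_torusAug n).comp
    (.of_linearEquiv (wordChain hn) (wordChain_totalDiff hn)) (totalDiff_mul_self hn)

theorem bidegree_toState (hn : 0 < n) (c : TorusWord n) :
    bidegree (toState hn c) = torusDegree n c := by
  rw [bidegree, sigma_toState, tau_toState, torusDegree]

theorem raisesDegree_torusAug_wordChain (hn : 0 < n) :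
    RaisesDegree bidegree (reducedDegree n) 0 (torusAug n ∘ₗ (wordChain hn).toLinearMap) :=
  fun z j hz => raisesDegree_torusAug n (wordChain hn z) j fun c hc =>
    hz (toState hn c) (by rw [bidegree_toState, hc])

theorem nonempty_khovanovHomology_torusLinkDiagram_equiv (hn : 0 < n) {a b : ℤ} {G : Type*}
    [AddCommGroup G] (hG : HasHomology (reducedDiff n) (reducedDegree n) (a, b) G) :
    Nonempty ((torusLinkDiagram n).KhovanovHomology a b ≃+ G) :=
  nonempty_khovanovHomology_equiv _ (isAcyclicSurjection_totalDiff hn) (totalDiff_mul_self hn)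
    (raisesDegree_torusAug_wordChain hn) hG

end Diagram

end Khovanov

theorem mainTheorem1 (n : ℕ) (hn : 0 < n) (a b : ℤ) :
    (((a = n ∧ b = n) ∨
        (2 ≤ n ∧ a = -n ∧ b = -3 * n) ∨
        (∃ s : ℕ, Even s ∧ s ≤ n ∧ a = n - 2 * s ∧ b = n - 4 * s + 4) ∨
        (∃ s : ℕ, Odd s ∧ 3 ≤ s ∧ s ≤ n ∧ a = n - 2 * s ∧ b = n - 4 * s)) →
      Nonempty ((torusLinkDiagram n).KhovanovHomology a b ≃+ ℤ)) ∧
    ((∃ s : ℕ, Odd s ∧ 3 ≤ s ∧ s ≤ n ∧ a = n - 2 * s ∧ b = n - 4 * s + 4) →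
      Nonempty ((torusLinkDiagram n).KhovanovHomology a b ≃+ ZMod 2)) ∧
    ((¬ ((a = n ∧ b = n) ∨
          (2 ≤ n ∧ a = -n ∧ b = -3 * n) ∨
          (∃ s : ℕ, Even s ∧ s ≤ n ∧ a = n - 2 * s ∧ b = n - 4 * s + 4) ∨
          (∃ s : ℕ, Odd s ∧ 3 ≤ s ∧ s ≤ n ∧ a = n - 2 * s ∧ b = n - 4 * s)) ∧
        ¬ ∃ s : ℕ, Odd s ∧ 3 ≤ s ∧ s ≤ n ∧ a = n - 2 * s ∧ b = n - 4 * s + 4) →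
      Subsingleton ((torusLinkDiagram n).KhovanovHomology a b)) := by
  refine ⟨fun h => ?_, fun h => ?_, fun ⟨hint, hzmod⟩ => ?_⟩
  · exact Khovanov.nonempty_khovanovHomology_torusLinkDiagram_equiv hn
      (Khovanov.hasHomology_reducedDiff_int hn h)
  · exact Khovanov.nonempty_khovanovHomology_torusLinkDiagram_equiv hn
      (Khovanov.hasHomology_reducedDiff_zmod_two h)
  · obtain ⟨e⟩ := Khovanov.nonempty_khovanovHomology_torusLinkDiagram_equiv hn
      (Khovanov.hasHomology_reducedDiff_punit.{0} hn hint hzmod)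
    exact e.injective.subsingleton
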